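/- **Definitions.** A *building graph* is $G=\langle V,E,EX,c,d\rangle$ with a finite vertex set $V$, edges $E\subseteq V\times V$, exits $EX\subsetneq V$, and integer-valued capacity and travel-time functions $c,d:V\cup E\to\mathbb Z$ with $d(v)=0$ for every vertex $v$. Let $P$ be a finite set of people with $c(v)\ge |P|$ for all $v\in EX$, and let $T=\{0,\dots,t_{\max}\}$. A *state* is a map $P\to V\cup E$. Fix an initial state $s_0$. A *weak evacuation schedule* (WES) is a sequence of states $(es(t))_{t\in T}$ with $es(0)=s_0$ such that, writing $es_p(t)$ for the location of $p$ at time $t$, for every $p\in P$: (1) if $es_p(t)=v_1\in V$, then $es_p(t+1)$ is $v_1$, or an edge $(v_1,v_2)\in E$, or a vertex $v_2$ with $(v_1,v_2)\in E$; (2) if $es_p(t)=e=(v_1,v_2)\in E$, then $es_p(t+1)\in\{e,v_1,v_2\}$; (3) if $e=(v_1,v_2)\in E$, $es_p(t)=v_1$ and $es_p(t+k)=v_2$ with $k\ge 0$, then $d(e)\le k$; (4) if $es_p(t')\in EX$ and $t'<t''\le t_{\max}$, then $es_p(t'')=es_p(t')$. A *strong evacuation schedule* (SES) is a WES in which, at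 every time, at most $c(x)$ people are at each $x\in V\cup E$, and in which every person is at an exit at time $t_{\max}$. A *behavior model* $\beta$ assigns to every SES $es$ a probability distribution $\beta(es)$ on the set of WESs. For $D\le t_{\max}$ let $N_{es'}(D)=|\{p\in P: es'_p(D)\in EX\}|$ and $\mathbb E[N_{es}(D)]=\sum_{es'}\beta(es)(es')\,N_{es'}(D)$, the sum being over all WESs $es'$. **The problem DEP.** Given an evacuation framework $\langle G,s_0,\beta\rangle$, a deadline $D\le t_{\max}$ and a number $K\le|P|$ ($K\in\mathbb N$), decide whether there is an SES $es$ with $\mathbb E[N_{es}(D)]\ge K$. In the input the vertices, people and time points are listed, integers are written in binary, and $\beta$ is given succinctly: by a multi-stack machine program, together with a parameter string and a time bound in unary, which on each SES $es$ outputs within the time bound a list of WESs with rational weights that specifies the distribution $\beta(es)$. **Theorem.** DEP is NP-hard: every language in NP is reducible to DEP by a polynomial-time many-one reduction. -/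

import Mathlib

namespace Evac

open Turing

/-! ### Building graphs and evacuation schedules -/

/-- A building graph `⟨V, E, EX, c, d⟩` on the vertex set `V`.  The capacity `c` and the travel
time `d` are integer valued functions on `V ∪ E`, and vertices have travel time `0`. -/
structure BuildingGraph (V : Type) [Fintype V] where
  E : Finset (V × V)
  EX : Finset V
  EX_ssubset : EX ⊂ Finset.univ
  c : V ⊕ {e // e ∈ E} → ℤ
  d : V ⊕ {e // e ∈ E} → ℤ
  d_vertex : ∀ v, d (Sum.inl v) = 0

variable {V P : Type} [Fintype V] [Fintype P]

/-- The locations `V ∪ E`. -/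
abbrev BuildingGraph.Loc (G : BuildingGraph V) : Type := V ⊕ {e // e ∈ G.E}

/-- A state places every person at a vertex or on an edge. -/
abbrev State (G : BuildingGraph V) (P : Type) : Type := P → G.Loc

/-- A sequence of states indexed by the time points `0, …, tmax`. -/
abbrev Schedule (G : BuildingGraph V) (P : Type) (tmax : ℕ) : Type :=
  Fin (tmax + 1) → State G P

/-- The conditions on a weak evacuation schedule. -/
structure IsWES {G : BuildingGraph V} {tmax : ℕ} (es : Schedule G P tmax) : Prop where
  /-- From a vertex one stays, enters an edge leaving it, or moves along such an edge. -/
  from_vertex : ∀ (p : P) (t t' : Fin (tmax + 1)), (t' : ℕ) = t + 1 →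
    ∀ v : V, es t p = Sum.inl v →
      es t' p = Sum.inl v ∨
      (∃ e : {e // e ∈ G.E}, e.1.1 = v ∧ es t' p = Sum.inr e) ∨
      (∃ e : {e // e ∈ G.E}, e.1.1 = v ∧ es t' p = Sum.inl e.1.2)
  /-- From an edge one stays on it or moves to one of its endpoints. -/
  from_edge : ∀ (p : P) (t t' : Fin (tmax + 1)), (t' : ℕ) = t + 1 →
    ∀ e : {e // e ∈ G.E}, es t p = Sum.inr e →
      es t' p = Sum.inr e ∨ es t' p = Sum.inl e.1.1 ∨ es t' p = Sum.inl e.1.2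
  /-- For an edge `e = (v₁, v₂)`, a person at `v₁` is at `v₂` only after at least `d e` units. -/
  travel_time : ∀ (p : P) (e : {e // e ∈ G.E}) (t t' : Fin (tmax + 1)), t ≤ t' →
    es t p = Sum.inl e.1.1 → es t' p = Sum.inl e.1.2 →
      G.d (Sum.inr e) ≤ (t' : ℤ) - (t : ℤ)
  /-- Nobody leaves an exit. -/
  exit_absorbing : ∀ (p : P) (t' t'' : Fin (tmax + 1)), t' < t'' →
    ∀ v ∈ G.EX, es t' p = Sum.inl v → es t'' p = Sum.inl v

open Classical in
/-- The additional conditions on a strong evacuation schedule. -/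
structure IsSES {G : BuildingGraph V} {tmax : ℕ} (es : Schedule G P tmax) : Prop
    extends IsWES es where
  vertex_capacity : ∀ (t : Fin (tmax + 1)) (v : V),
    ((Finset.univ.filter fun p => es t p = Sum.inl v).card : ℤ) ≤ G.c (Sum.inl v)
  edge_capacity : ∀ (t : Fin (tmax + 1)) (e : {e // e ∈ G.E}),
    ((Finset.univ.filter fun p => es t p = Sum.inr e).card : ℤ) ≤ G.c (Sum.inr e)
  all_evacuated : ∀ p : P, ∃ v ∈ G.EX, es (Fin.last tmax) p = Sum.inl v

/-- The weak evacuation schedules that start in the state `s₀`. -/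
def WES (G : BuildingGraph V) (s₀ : State G P) (tmax : ℕ) : Type :=
  {es : Schedule G P tmax // IsWES es ∧ es 0 = s₀}

/-- The strong evacuation schedules that start in the state `s₀`. -/
def SES (G : BuildingGraph V) (s₀ : State G P) (tmax : ℕ) : Type :=
  {es : Schedule G P tmax // IsSES es ∧ es 0 = s₀}

noncomputable instance (G : BuildingGraph V) (s₀ : State G P) (tmax : ℕ) :
    Fintype (WES G s₀ tmax) :=
  haveI : Finite (WES G s₀ tmax) := by unfold WES; infer_instance
  Fintype.ofFinite _

/-- A behavior model sends every SES to a probability distribution `ω` on the set of WESs, that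
is, to a nonnegative function with sum `1`. -/
abbrev BehaviorModel (G : BuildingGraph V) (s₀ : State G P) (tmax : ℕ) : Type :=
  SES G s₀ tmax → stdSimplex ℝ (WES G s₀ tmax)

open Classical in
/-- The number of people evacuated by the deadline `D ≤ tmax`. -/
noncomputable def numEvacuated {G : BuildingGraph V} {tmax : ℕ} (es : Schedule G P tmax)
    (D : Fin (tmax + 1)) : ℕ :=
  (Finset.univ.filter fun p => ∃ v ∈ G.EX, es D p = Sum.inl v).card

/-- The expected number of people evacuated by `D` if the population is told to follow `es` and
behaves according to `β`.  (Schedules of probability zero contribute nothing to the sum.) -/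
noncomputable def expectedEvacuated {G : BuildingGraph V} {s₀ : State G P} {tmax : ℕ}
    (β : BehaviorModel G s₀ tmax) (es : SES G s₀ tmax) (D : Fin (tmax + 1)) : ℝ :=
  ∑ w : WES G s₀ tmax, (β es).1 w * (numEvacuated w.1 D : ℝ)

/-- An instance of DEP: an evacuation framework `⟨G, s₀, β⟩` with vertices `0, …, n - 1`, people
`0, …, m - 1` and time points `0, …, tmax`, in which every exit can hold all people, together
with a deadline `D ≤ tmax` and a number `K ≤ m`. -/
structure Instance where
  n : ℕ
  m : ℕ
  tmax : ℕ
  G : BuildingGraph (Fin n)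
  exit_capacity : ∀ v ∈ G.EX, (m : ℤ) ≤ G.c (Sum.inl v)
  s₀ : State G (Fin m)
  β : BehaviorModel G s₀ tmax
  D : Fin (tmax + 1)
  K : ℕ
  K_le : K ≤ m

/-- The question asked by DEP. -/
def Instance.IsYes (I : Instance) : Prop :=
  ∃ es : SES I.G I.s₀ I.tmax, (I.K : ℝ) ≤ expectedEvacuated I.β es I.D

/-! ### Encoding by strings

Every block below is self-delimiting. Numbers are written in binary (least significant digit
first); the sets of vertices, people and time points are listed, hence have unary size. -/

inductive Symbol
  | zero
  | one
  | lpar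
  | rpar

def encBit : Bool → Symbol
  | false => Symbol.zero
  | true => Symbol.one

def encBits (l : List Bool) : List Symbol := Symbol.lpar :: (l.map encBit ++ [Symbol.rpar])

def encNat (n : ℕ) : List Symbol := encBits n.bits

def encUnary (n : ℕ) : List Symbol := encBits (List.replicate n true)

def encInt : ℤ → List Symbol
  | Int.ofNat n => Symbol.zero :: encNat n
  | Int.negSucc n => Symbol.one :: encNat n

def encList {α : Type} (f : α → List Symbol) (l : List α) : List Symbol :=
  Symbol.lpar :: (l.flatMap f ++ [Symbol.rpar])

def encLoc {n : ℕ} {G : BuildingGraph (Fin n)} : G.Loc → List Symbol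
  | Sum.inl v => Symbol.zero :: encNat v
  | Sum.inr e => Symbol.one :: (encNat e.1.1 ++ encNat e.1.2)

def encState {n m : ℕ} {G : BuildingGraph (Fin n)} (s : State G (Fin m)) : List Symbol :=
  encList encLoc (List.ofFn s)

def encSchedule {n m tmax : ℕ} {G : BuildingGraph (Fin n)} (es : Schedule G (Fin m) tmax) :
    List Symbol :=
  encList encState (List.ofFn es)

/-- The list of vertices (capacity, exit or not) and the adjacency matrix, whose nonzero entries
carry the capacity and the travel time of the edge. -/
def encGraph {n : ℕ} (G : BuildingGraph (Fin n)) : List Symbol :=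
  encList (fun v => encBit (decide (v ∈ G.EX)) :: encInt (G.c (Sum.inl v))) (List.finRange n) ++
  encList (fun u => encList (fun v =>
      if h : (u, v) ∈ G.E then
        Symbol.one :: (encInt (G.c (Sum.inr ⟨(u, v), h⟩)) ++ encInt (G.d (Sum.inr ⟨(u, v), h⟩)))
      else [Symbol.zero])
    (List.finRange n)) (List.finRange n)

/-! ### Finite descriptions of behavior models

The set of SESs is in general exponentially large, so a behavior model is specified succinctly:
by a program that computes, for a given SES, the list of WESs of positive probability with their
probabilities.  The program comes with a bound on its running time, written in unary. -/

/-- Instructions of a machine with finitely many stacks. -/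
inductive Instr
  /-- Push the symbol `a` on stack `k` and go to instruction `next`. -/
  | push (k a next : ℕ)
  /-- Pop stack `k`: go to `onEmpty` if it is empty, otherwise to the entry of `onSymbol` whose
  index is the symbol that was removed. -/
  | pop (k onEmpty : ℕ) (onSymbol : List ℕ)

/-- A configuration: the current instruction and the contents of the stacks, top first. -/
structure Config where
  pc : ℕ
  stk : ℕ → List ℕ

/-- One step of a program.  The program has halted once `pc` is not the index of an
instruction. -/
def step (code : List Instr) (C : Config) : Config :=
  match code[C.pc]? with
  | none => C
  | some (Instr.push k a next) => ⟨next, Function.update C.stk k (a :: C.stk k)⟩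
  | some (Instr.pop k onEmpty onSymbol) =>
    match C.stk k with
    | [] => ⟨onEmpty, C.stk⟩
    | a :: r => ⟨onSymbol.getD a code.length, Function.update C.stk k r⟩

def Symbol.toNat : Symbol → ℕ
  | zero => 0
  | one => 1
  | lpar => 2
  | rpar => 3

/-- A program, a string of parameters available to it, and a bound on its running time. -/
structure BehaviorCode where
  code : List Instr
  data : List Bool
  clock : ℕ

/-- Initially the input is on stack `0`, the parameters are on stack `1`, and all other stacks
are empty. -/
def BehaviorCode.init (B : BehaviorCode) (input : List Symbol) : Config where
  pc := 0
  stk k :=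
    if k = 0 then input.map Symbol.toNat
    else if k = 1 then B.data.map Bool.toNat
    else []

/-- On the given input the program halts after at most `B.clock` steps, with the given output on
stack `2`. -/
def BehaviorCode.Outputs (B : BehaviorCode) (input output : List Symbol) : Prop :=
  let C := (step B.code)^[B.clock] (B.init input)
  B.code.length ≤ C.pc ∧ C.stk 2 = output.map Symbol.toNat

open Classical in
/-- `B` describes `β`: given any SES `es`, it outputs a list of pairs (probability, WES) that
specifies the distribution `β es`. -/
def BehaviorCode.Describes (B : BehaviorCode) {n m tmax : ℕ} {G : BuildingGraph (Fin n)}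
    {s₀ : State G (Fin m)} (β : BehaviorModel G s₀ tmax) : Prop :=
  ∀ es : SES G s₀ tmax, ∃ l : List (ℚ≥0 × WES G s₀ tmax),
    B.Outputs (encSchedule es.1)
      (encList (fun x => encNat x.1.num ++ (encNat x.1.den ++ encSchedule x.2.1)) l) ∧
    ∀ w : WES G s₀ tmax, (β es).1 w = (l.map fun x => if x.2 = w then (x.1 : ℝ) else 0).sum

def encInstr : Instr → List Symbol
  | Instr.push k a next => Symbol.zero :: (encNat k ++ (encNat a ++ encNat next))
  | Instr.pop k onEmpty onSymbol =>
    Symbol.one :: (encNat k ++ (encNat onEmpty ++ encList encNat onSymbol))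

def BehaviorCode.enc (B : BehaviorCode) : List Symbol :=
  encList encInstr B.code ++ (encBits B.data ++ encUnary B.clock)

/-- The string for the instance `I`, whose behavior model is described by `B`. -/
def Instance.enc (I : Instance) (B : BehaviorCode) : List Symbol :=
  encGraph I.G ++ (encState I.s₀ ++ (encUnary I.tmax ++ (encNat I.D ++ (encNat I.K ++ B.enc))))

/-- The decision problem DEP: the set of strings that encode its yes-instances. -/
def DEP : Language Symbol :=
  {s | ∃ (I : Instance) (B : BehaviorCode), B.Describes I.β ∧ I.enc B = s ∧ I.IsYes}

/-! ### NP-hardness -/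

/-- The string `x#w`. -/
def encPair (xw : List Bool × List Bool) : List (Option Bool) :=
  xw.1.map some ++ none :: xw.2.map some

/-- `L` is in NP: membership is witnessed by certificates of polynomial length that are checked
by a Turing machine in polynomial time. -/
def InNP (L : Language Bool) : Prop :=
  ∃ (p : Polynomial ℕ) (verify : List Bool × List Bool → Bool),
    Nonempty (TM2ComputableInPolyTime encPair Computability.encodeBool verify) ∧
    ∀ x : List Bool, x ∈ L ↔ ∃ w : List Bool, w.length ≤ p.eval x.length ∧ verify (x, w) = true

/-- Polynomial-time many-one (Karp) reducibility. -/
def PolyTimeReducible {Γ Δ : Type} (L : Language Γ) (A : Language Δ) : Prop :=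
  ∃ f : List Γ → List Δ,
    Nonempty (TM2ComputableInPolyTime (id : List Γ → List Γ) (id : List Δ → List Δ) f) ∧
    ∀ x : List Γ, x ∈ L ↔ f x ∈ A

def NPHard {Δ : Type} (A : Language Δ) : Prop :=
  ∀ L : Language Bool, InNP L → PolyTimeReducible L A

end Evac

/-! A behavior model may be any efficiently computable map, so it can check NP certificates. Let `x
∈ L` mean that some `w` with `|w| ≤ N = p(|x|)` is accepted by `verify`. One person walks in a
building with two rooms and an exit, where all pairs of vertices are edges, travel is instantaneous
and edges have capacity 0. A strong schedule is then a walk on vertices. Visits to the rooms after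
time 0 spell the bits of a certificate, and the exit spells nothing. With `tmax = N + 1` these
certificates are exactly the strings of length at most `N`. The behavior model reads the certificate
off the schedule. If `verify (x, w)` holds, it puts all mass on the schedule that is at the exit
from time 1 on; otherwise on the one that stays in the room, which is weak but not strong. With `D =
K = 1` the instance is a yes-instance iff `x ∈ L` (`certInstance_isYes`).

Two computability statements remain. The behavior model needs a program with a polynomial clock,
obtained by simulating the verifier (`exists_behaviorCode`), and the instance must be printed in
polynomial time (`polyTime_print`). Both programs are written in the structured language `Cmd`. Its
flow graphs are translated into Turing machines by `polyTime_of_runsWithin` and into instruction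
lists by `exists_code`. The instruction list depends only on the verifier; `x` enters as the
parameter string.

Finally, DEP is a set of strings, so a no-instance must not share its string with a yes-instance.
All codes are self-delimiting and a program describes at most one behavior model, hence an instance
is determined by its string (`instance_enc_unique`). -/

namespace Evac

open Turing

/-! ### A structured language for stack machines -/

/-- Structured programs over stacks indexed by `K`, stack `k` holding symbols from `Γ k`.
`pop k e f` pops stack `k` and continues with `e` if it was empty and with `f a` if the symbol
`a` was removed; `loop k f` pops stack `k` until it is empty, running `f a` for each symbol. -/
inductive Cmd {K : Type} (Γ : K → Type) : Type
  | skip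
  | push (k : K) (a : Γ k)
  | seq (c d : Cmd Γ)
  | pop (k : K) (e : Cmd Γ) (f : Γ k → Cmd Γ)
  | loop (k : K) (f : Γ k → Cmd Γ)

/-- The contents of the stacks, top first. -/
abbrev Store {K : Type} (Γ : K → Type) : Type := ∀ k, List (Γ k)

section Language

variable {K : Type} {Γ : K → Type}

/-- An operation of a flow graph with labels `L`. -/
inductive FlowOp (Γ : K → Type) (L : Type) : Type
  | push (k : K) (a : Γ k) (next : L)
  | pop (k : K) (e : L) (f : Γ k → L)

/-- Renaming of labels. -/
def FlowOp.map {L L' : Type} (g : L → L') : FlowOp Γ L → FlowOp Γ L'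
  | push k a next => push k a (g next)
  | pop k e f => pop k (g e) fun a => g (f a)

theorem FlowOp.map_map {L L' L'' : Type} (g : L → L') (g' : L' → L'') (o : FlowOp Γ L) :
    (o.map g).map g' = o.map fun l => g' (g l) := by
  cases o <;> rfl

variable [DecidableEq K]

/-- `Runs c S n S'`: started with the stacks `S`, the program `c` ends with the stacks `S'` after
exactly `n` elementary operations. -/
inductive Runs : Cmd Γ → Store Γ → ℕ → Store Γ → Prop
  | skip (S) : Runs .skip S 0 S
  | push (S k a) : Runs (.push k a) S 1 (Function.update S k (a :: S k))
  | seq {c d S n S' m S''} (h : Runs c S n S') (h' : Runs d S' m S'') :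
      Runs (.seq c d) S (n + m) S''
  | pop_nil {k e f S n S'} (hk : S k = []) (h : Runs e S n S') : Runs (.pop k e f) S (1 + n) S'
  | pop_cons {k e f S a r n S'} (hk : S k = a :: r)
      (h : Runs (f a) (Function.update S k r) n S') : Runs (.pop k e f) S (1 + n) S'
  | loop_nil {k f S} (hk : S k = []) : Runs (.loop k f) S 1 S
  | loop_cons {k f S a r n S' m S''} (hk : S k = a :: r)
      (h : Runs (f a) (Function.update S k r) n S') (h' : Runs (.loop k f) S' m S'') :
      Runs (.loop k f) S (1 + (n + m)) S''

/-- `c` transforms `S` into `S'` with at most `t` elementary operations. -/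
def RunsWithin (c : Cmd Γ) (S : Store Γ) (t : ℕ) (S' : Store Γ) : Prop :=
  ∃ n ≤ t, Runs c S n S'

theorem Runs.within {c : Cmd Γ} {S S' : Store Γ} {n : ℕ} (h : Runs c S n S') :
    RunsWithin c S n S' := ⟨n, le_rfl, h⟩

theorem RunsWithin.mono {c : Cmd Γ} {S S' : Store Γ} {t u : ℕ} (h : RunsWithin c S t S')
    (htu : t ≤ u) : RunsWithin c S u S' :=
  let ⟨n, hn, h⟩ := h
  ⟨n, hn.trans htu, h⟩

theorem RunsWithin.congr {c : Cmd Γ} {S S' R R' : Store Γ} {t u : ℕ} (h : RunsWithin c S t S')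
    (hS : R = S) (hS' : S' = R') (htu : t ≤ u) : RunsWithin c R u R' := by
  subst hS hS'
  exact h.mono htu

theorem RunsWithin.seq {c d : Cmd Γ} {S S' S'' : Store Γ} {t u : ℕ} (h : RunsWithin c S t S')
    (h' : RunsWithin d S' u S'') : RunsWithin (.seq c d) S (t + u) S'' :=
  let ⟨_, hn, h⟩ := h
  let ⟨_, hm, h'⟩ := h'
  ⟨_, Nat.add_le_add hn hm, h.seq h'⟩

theorem RunsWithin.pop_nil {k : K} {e : Cmd Γ} {f : Γ k → Cmd Γ} {S S' : Store Γ} {t : ℕ}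
    (hk : S k = []) (h : RunsWithin e S t S') : RunsWithin (.pop k e f) S (1 + t) S' :=
  let ⟨_, hn, h⟩ := h
  ⟨_, Nat.add_le_add_left hn 1, h.pop_nil hk⟩

theorem RunsWithin.pop_cons {k : K} {e : Cmd Γ} {f : Γ k → Cmd Γ} {S S' : Store Γ} {t : ℕ}
    {a : Γ k} {r : List (Γ k)} (hk : S k = a :: r)
    (h : RunsWithin (f a) (Function.update S k r) t S') :
    RunsWithin (.pop k e f) S (1 + t) S' :=
  let ⟨_, hn, h⟩ := h
  ⟨_, Nat.add_le_add_left hn 1, h.pop_cons hk⟩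

theorem RunsWithin.loop_cons {k : K} {f : Γ k → Cmd Γ} {S S' S'' : Store Γ} {t u : ℕ}
    {a : Γ k} {r : List (Γ k)} (hk : S k = a :: r)
    (h : RunsWithin (f a) (Function.update S k r) t S') (h' : RunsWithin (.loop k f) S' u S'') :
    RunsWithin (.loop k f) S (1 + (t + u)) S'' :=
  let ⟨_, hn, h⟩ := h
  let ⟨_, hm, h'⟩ := h'
  ⟨_, Nat.add_le_add_left (Nat.add_le_add hn hm) 1, h.loop_cons hk h'⟩

/-- Push the string `l`, so that its first symbol ends up on top. -/
def Cmd.pushAll (k : K) : List (Γ k) → Cmd Γ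
  | [] => .skip
  | a :: l => .seq (pushAll k l) (.push k a)

theorem runs_pushAll (k : K) (l : List (Γ k)) (S : Store Γ) :
    Runs (.pushAll k l) S l.length (Function.update S k (l ++ S k)) := by
  induction l with
  | nil => simpa [Cmd.pushAll] using Runs.skip S
  | cons a l ih => simpa [Cmd.pushAll] using ih.seq (Runs.push _ k a)

/-- Emptying stack `k` while pushing the string `h a` on another stack for each symbol `a`. -/
theorem runs_loop_pushAll {k k' : K} (hk : k' ≠ k) (h : Γ k → List (Γ k')) (c : ℕ)
    (hc : ∀ a, (h a).length ≤ c) (l : List (Γ k)) (S : Store Γ) (hl : S k = l) :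
    RunsWithin (.loop k fun a => .pushAll k' (h a)) S ((c + 1) * l.length + 1)
      (Function.update (Function.update S k []) k' (l.reverse.flatMap h ++ S k')) := by
  induction l generalizing S with
  | nil =>
    have := (Runs.loop_nil (f := fun a => Cmd.pushAll k' (h a)) hl).within
    have hS : Function.update S k [] = S := by rw [← hl, Function.update_eq_self]
    simpa [hS] using this
  | cons a l ih =>
    have h1 := (runs_pushAll k' (h a) (Function.update S k l)).within.mono (hc a)
    have h2 := ih (Function.update (Function.update S k l) k'
      (h a ++ (Function.update S k l) k')) (by simp [hk.symm])
    have := RunsWithin.loop_cons (f := fun a => Cmd.pushAll k' (h a)) hl h1 h2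
    convert this.mono (u := (c + 1) * (a :: l).length + 1)
      (by rw [List.length_cons]; ring_nf; omega) using 1
    funext j
    by_cases hj : j = k'
    · subst hj; simp [hk]
    · by_cases hj' : j = k
      · subst hj'; simp [hj]
      · simp [hj, hj']

/-! ### Flow graphs -/

/-- The effect of an operation. -/
def FlowOp.exec {L : Type} : FlowOp Γ L → Store Γ → L × Store Γ
  | push k a next, S => (next, Function.update S k (a :: S k))
  | pop k e f, S =>
    match S k with
    | [] => (e, S)
    | a :: r => (f a, Function.update S k r)

/-- One step of a flow graph; the label `none` means that it has halted. -/
def flowStep {L : Type} (G : L → FlowOp Γ (Option L)) (C : Option L × Store Γ) :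
    Option L × Store Γ :=
  match C.1 with
  | none => C
  | some l => (G l).exec C.2

/-- The labels of the flow graph of a program. -/
inductive Cmd.Label : Cmd Γ → Type
  | push {k a} : Label (.push k a)
  | left {c d} (l : Label c) : Label (.seq c d)
  | right {c d} (l : Label d) : Label (.seq c d)
  | popHead {k e f} : Label (.pop k e f)
  | popNil {k e f} (l : Label e) : Label (.pop k e f)
  | popCons {k e f} (a : Γ k) (l : Label (f a)) : Label (.pop k e f)
  | loopHead {k f} : Label (.loop k f)
  | loopBody {k f} (a : Γ k) (l : Label (f a)) : Label (.loop k f)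

/-- The label at which a program starts; `none` if there is nothing to do. -/
def Cmd.entry : (c : Cmd Γ) → Option c.Label
  | skip => none
  | push _ _ => some .push
  | seq c d => c.entry.elim (d.entry.map .right) (fun l => some (.left l))
  | pop _ _ _ => some .popHead
  | loop _ _ => some .loopHead

/-- The flow graph of a program; `none` is its exit. -/
def Cmd.flow : {c : Cmd Γ} → c.Label → FlowOp Γ (Option c.Label)
  | _, .push (k := k) (a := a) => .push k a none
  | _, .left (d := d) l =>
    (flow l).map fun o => o.elim (d.entry.map .right) (fun l => some (.left l))
  | _, .right l => (flow l).map (Option.map .right)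
  | _, .popHead (k := k) (e := e) (f := f) =>
    .pop k (e.entry.map .popNil) fun a => (f a).entry.map (.popCons a)
  | _, .popNil l => (flow l).map (Option.map .popNil)
  | _, .popCons a l => (flow l).map (Option.map (.popCons a))
  | _, .loopHead (k := k) (f := f) =>
    .pop k none fun a => some ((f a).entry.elim .loopHead (.loopBody a))
  | _, .loopBody a l => (flow l).map fun o => some (o.elim .loopHead (.loopBody a))

instance Cmd.finite_label [∀ k, Finite (Γ k)] (c : Cmd Γ) : Finite c.Label := by
  induction c with
  | skip => exact Finite.of_injective (β := Empty) (fun l => nomatch l) (fun l => nomatch l)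
  | push k a =>
    exact Finite.of_surjective (α := Unit) (fun _ => .push) (fun | .push => ⟨(), rfl⟩)
  | seq c d hc hd =>
    exact Finite.of_surjective (α := c.Label ⊕ d.Label) (Sum.elim .left .right)
      (fun | .left l => ⟨.inl l, rfl⟩ | .right l => ⟨.inr l, rfl⟩)
  | pop k e f he hf =>
    exact Finite.of_surjective (α := Option (e.Label ⊕ Σ a, (f a).Label))
      (fun o => o.elim .popHead (Sum.elim .popNil fun p => .popCons p.1 p.2))
      (fun
        | .popHead => ⟨none, rfl⟩
        | .popNil l => ⟨some (.inl l), rfl⟩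
        | .popCons a l => ⟨some (.inr ⟨a, l⟩), rfl⟩)
  | loop k f hf =>
    exact Finite.of_surjective (α := Option (Σ a, (f a).Label))
      (fun o => o.elim .loopHead fun p => .loopBody p.1 p.2)
      (fun | .loopHead => ⟨none, rfl⟩ | .loopBody a l => ⟨some ⟨a, l⟩, rfl⟩)

theorem iterate_trans {α : Type} {f : α → α} {a b c : α} {m n : ℕ} (h : f^[m] a = b)
    (h' : f^[n] b = c) : f^[m + n] a = c := by
  rw [Nat.add_comm, Function.iterate_add_apply, h, h']

/-- A program runs correctly as a part of any larger flow graph. -/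
theorem Runs.flow {c : Cmd Γ} {S S' : Store Γ} {n : ℕ} (h : Runs c S n S') {L : Type}
    (G : L → FlowOp Γ (Option L)) (ι : c.Label → L) (x : Option L)
    (hG : ∀ l, G (ι l) = (Cmd.flow l).map fun o => o.elim x fun l => some (ι l)) :
    (flowStep G)^[n] (c.entry.elim x (fun l => some (ι l)), S) = (x, S') := by
  induction h generalizing x with
  | skip S => rfl
  | push S k a =>
    have := hG .push
    simp only [Cmd.flow, FlowOp.map] at this
    simp only [Function.iterate_one, flowStep, Cmd.entry, Option.elim, this, FlowOp.exec]
  | @seq c d S n S' m S'' h h' ih ih' =>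
    -- The exit of the first part is the entry of the second, or the common exit if the second part
    -- is empty.
    have h1 := ih (fun l => ι (.left l)) (d.entry.elim x fun l => some (ι (.right l)))
      (fun l => by
        rw [hG]
        simp only [Cmd.flow, FlowOp.map_map]
        congr 1
        funext o
        cases o with
        | none => cases d.entry <;> rfl
        | some l => rfl)
    have h2 := ih' (fun l => ι (.right l)) x (fun l => by
        rw [hG]
        simp only [Cmd.flow, FlowOp.map_map]
        congr 1
        funext o
        cases o <;> rfl)
    have h3 := iterate_trans h1 h2
    rw [← h3]
    simp only [Cmd.entry]
    cases hc : c.entry with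
    | none => cases d.entry <;> rfl
    | some l => rfl
  | @pop_nil k e f S n S' hk h ih =>
    have h1 := ih (fun l => ι (.popNil l)) x (fun l => by
        rw [hG]
        simp only [Cmd.flow, FlowOp.map_map]
        congr 1
        funext o
        cases o <;> rfl)
    refine iterate_trans (m := 1) ?_ h1
    have := hG .popHead
    simp only [Function.iterate_one, flowStep, Cmd.entry, Option.elim, this, Cmd.flow,
      FlowOp.map, FlowOp.exec, hk]
    cases e.entry <;> rfl
  | @pop_cons k e f S a r n S' hk h ih =>
    have h1 := ih (fun l => ι (.popCons a l)) x (fun l => by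
        rw [hG]
        simp only [Cmd.flow, FlowOp.map_map]
        congr 1
        funext o
        cases o <;> rfl)
    refine iterate_trans (m := 1) ?_ h1
    have := hG .popHead
    simp only [Function.iterate_one, flowStep, Cmd.entry, Option.elim, this, Cmd.flow,
      FlowOp.map, FlowOp.exec, hk]
    cases (f a).entry <;> rfl
  | @loop_nil k f S hk =>
    have := hG .loopHead
    simp only [Function.iterate_one, flowStep, Cmd.entry, Option.elim, this, Cmd.flow,
      FlowOp.map, FlowOp.exec, hk]
  | @loop_cons k f S a r n S' m S'' hk h h' ih ih' =>
    -- The loop body exits to the loop head, from which the remaining iterations start.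
    have h1 := ih (fun l => ι (.loopBody a l)) (some (ι .loopHead)) (fun l => by
        rw [hG]
        simp only [Cmd.flow, FlowOp.map_map]
        congr 1
        funext o
        cases o <;> rfl)
    refine iterate_trans (m := 1) ?_ (iterate_trans h1 (ih' ι x hG))
    have := hG .loopHead
    simp only [Function.iterate_one, flowStep, Cmd.entry, Option.elim, this, Cmd.flow,
      FlowOp.map, FlowOp.exec, hk]
    cases (f a).entry <;> rfl

theorem Runs.flow_self {c : Cmd Γ} {S S' : Store Γ} {n : ℕ} (h : Runs c S n S') :
    (flowStep (Cmd.flow (c := c)))^[n] (c.entry, S) = (none, S') := by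
  have := h.flow Cmd.flow id none (fun l => by
    have : (fun o : Option c.Label => o.elim none fun l => some (id l)) = id := by
      funext o; cases o <;> rfl
    rw [this]
    cases h : Cmd.flow l <;> exact h)
  rw [← this]
  cases c.entry <;> rfl

end Language

/-! ### Programs as Turing machines -/

section TuringMachine

variable {K : Type} [DecidableEq K] {Γ : K → Type}

/-- The store with the string `x` on stack `k` and nothing else. -/
def Store.single (k : K) (x : List (Γ k)) : Store Γ := Function.update (fun _ => []) k x

theorem initList_stk (tm : FinTM2) (s : List (tm.Γ tm.k₀)) :
    (initList tm s).stk = Store.single tm.k₀ s := by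
  funext k
  by_cases hk : k = tm.k₀
  · subst hk; simp [initList, Store.single]
  · simp [initList, Store.single, hk]

theorem haltList_stk (tm : FinTM2) (s : List (tm.Γ tm.k₁)) :
    (haltList tm s).stk = Store.single tm.k₁ s := by
  funext k
  by_cases hk : k = tm.k₁
  · subst hk; simp [haltList, Store.single]
  · simp [haltList, Store.single, hk]

/-- A flow graph operation as a Turing machine statement; the next label is kept in the internal
state of the machine. -/
def FlowOp.toStmt {L : Type} : FlowOp Γ L → TM2.Stmt Γ L L
  | push k a next => .push k (fun _ => a) (.goto fun _ => next)
  | pop k e f => .pop k (fun _ o => o.elim e f) (.goto id)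

/-- The Turing machine of a program. -/
def Cmd.machine (c : Cmd Γ) : Option c.Label → TM2.Stmt Γ (Option c.Label) (Option c.Label)
  | none => .load (fun _ => none) .halt
  | some l => (Cmd.flow l).toStmt

/-- A `goto` may depend on the internal state but not on the symbol just popped, so `pop` stores its
target in the state. The state has no other role and is left existential. -/
theorem FlowOp.stepAux_toStmt {L : Type} (o : FlowOp Γ L) (v : L) (S : Store Γ) :
    ∃ v', TM2.stepAux o.toStmt v S = ⟨some (o.exec S).1, v', (o.exec S).2⟩ := by
  cases o with
  | push k a next => exact ⟨v, rfl⟩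
  | pop k e f =>
    simp only [FlowOp.toStmt, FlowOp.exec, TM2.stepAux]
    cases hk : S k with
    | nil =>
      refine ⟨e, ?_⟩
      have : Function.update S k [] = S := by rw [← hk, Function.update_eq_self]
      simp [this]
    | cons a r => exact ⟨f a, rfl⟩

/-- The additional step is the final `halt`. It also resets the internal state to `none`, because
`haltList` asks for the initial state. -/
theorem Cmd.machine_evals (c : Cmd Γ) (n : ℕ) (o v : Option c.Label) (S S' : Store Γ)
    (h : (flowStep Cmd.flow)^[n] (o, S) = (none, S')) :
    ∃ m ≤ n + 1, (flip bind (TM2.step c.machine))^[m] (some ⟨some o, v, S⟩) =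
      some ⟨none, none, S'⟩ := by
  induction n generalizing o v S with
  | zero =>
    obtain ⟨rfl, rfl⟩ : o = none ∧ S = S' := by simpa using h
    exact ⟨1, by simp, rfl⟩
  | succ n ih =>
    cases o with
    | none =>
      have hfix : ∀ m, (flowStep (Cmd.flow (c := c)))^[m] (none, S) = (none, S) := fun m =>
        Function.iterate_fixed rfl m
      rw [hfix] at h
      obtain rfl : S = S' := by simpa using h
      exact ⟨1, by simp, rfl⟩
    | some l =>
      rw [Function.iterate_succ_apply] at h
      obtain ⟨v', hv⟩ := (Cmd.flow l).stepAux_toStmt v S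
      obtain ⟨m, hm, h'⟩ := ih _ v' _ h
      refine ⟨m + 1, by omega, ?_⟩
      rw [Function.iterate_succ_apply, ← h']
      congr 1
      exact congrArg some hv

/-- A function computed by a program in polynomial time is computed by a Turing machine in
polynomial time. -/
theorem polyTime_of_runsWithin [Fintype K] [∀ k, Finite (Γ k)] (c : Cmd Γ) (i o : K)
    [Fintype (Γ i)] (T : Polynomial ℕ) (f : List (Γ i) → List (Γ o))
    (h : ∀ x, RunsWithin c (.single i x) (T.eval x.length) (.single o (f x))) :
    Nonempty (TM2ComputableInPolyTime (id : List (Γ i) → _) (id : List (Γ o) → _) f) := by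
  classical
  have : Fintype (Option c.Label) := Fintype.ofFinite _
  let tm : FinTM2 :=
    { K := K, k₀ := i, k₁ := o, Γ := Γ, Λ := Option c.Label, main := c.entry,
      σ := Option c.Label, initialState := none, m := c.machine }
  refine ⟨⟨⟨tm, Equiv.refl _, Equiv.refl _⟩, T + 1, fun x => Classical.choice ?_⟩⟩
  obtain ⟨n, hn, hr⟩ := h x
  obtain ⟨m, hm, he⟩ := c.machine_evals n c.entry none _ _ hr.flow_self
  refine ⟨⟨⟨m, ?_⟩, ?_⟩⟩
  · have h1 : initList tm (List.map (Equiv.refl (Γ i)).invFun (id x)) =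
        ⟨some c.entry, none, Store.single i x⟩ := by
      refine congrArg (TM2.Cfg.mk (some c.entry) none) ?_
      exact (initList_stk tm _).trans (congrArg (Store.single i) (List.map_id _))
    have h2 : haltList tm (List.map (Equiv.refl (Γ o)).invFun (id (f x))) =
        ⟨none, none, Store.single o (f x)⟩ := by
      refine congrArg (TM2.Cfg.mk none none) ?_
      exact (haltList_stk tm _).trans (congrArg (Store.single o) (List.map_id _))
    erw [h1]
    simp only [Option.map]
    erw [h2]
    exact he
  · simp only [id, Polynomial.eval_add, Polynomial.eval_one]
    omega

end TuringMachine

/-! ### Programs as instruction lists -/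

section Instructions

variable {K : Type} [DecidableEq K] {Γ : K → Type}

/-- The entry of a jump table: `t` lists the values of `g` at the symbols, by their codes. -/
theorem exists_jumpTable {A : Type} [Finite A] (τ : A → ℕ) (hτ : Function.Injective τ)
    (g : A → ℕ) : ∃ t : List ℕ, ∀ a d, t.getD (τ a) d = g a := by
  classical
  obtain ⟨B, hB⟩ := (Set.finite_range τ).bddAbove
  -- Indices that are not codes of symbols get the dummy entry 0, which is never consulted.
  refine ⟨(List.range (B + 1)).map fun i => if h : ∃ a, τ a = i then g h.choose else 0, ?_⟩
  intro a d
  have ha : τ a < B + 1 := Nat.lt_succ_of_le (hB ⟨a, rfl⟩)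
  have hex : ∃ b, τ b = τ a := ⟨a, rfl⟩
  have := hτ hex.choose_spec
  simp [List.getD_eq_getElem?_getD, ha, this]

/-- The instruction for a flow graph operation, given the numbering of the stacks and symbols and
the addresses of the labels. -/
noncomputable def FlowOp.toInstr [∀ k, Finite (Γ k)] {L : Type} (κ : K → ℕ)
    (τ : ∀ k, Γ k → ℕ) (hτ : ∀ k, Function.Injective (τ k)) (addr : L → ℕ) :
    FlowOp Γ L → Instr
  | push k a next => .push (κ k) (τ k a) (addr next)
  | pop k e f =>
    .pop (κ k) (addr e) (exists_jumpTable (τ k) (hτ k) fun a => addr (f a)).choose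

/-- The numbered stacks `s` hold the contents of the store `S`. -/
def Represents (κ : K → ℕ) (τ : ∀ k, Γ k → ℕ) (s : ℕ → List ℕ) (S : Store Γ) : Prop :=
  ∀ k, s (κ k) = (S k).map (τ k)

theorem Represents.update {κ : K → ℕ} (hκ : Function.Injective κ) {τ : ∀ k, Γ k → ℕ}
    {s : ℕ → List ℕ} {S : Store Γ} (h : Represents κ τ s S) (k : K) (l : List (Γ k)) :
    Represents κ τ (Function.update s (κ k) (l.map (τ k))) (Function.update S k l) := by
  intro j
  by_cases hj : j = k
  · subst hj; simp
  · simp [hj, hκ.ne hj, h j]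

/-- Every program can be written as a list of instructions. -/
theorem exists_code [∀ k, Finite (Γ k)] (κ : K → ℕ) (hκ : Function.Injective κ)
    (τ : ∀ k, Γ k → ℕ) (hτ : ∀ k, Function.Injective (τ k)) (c : Cmd Γ) (l₀ : c.Label)
    (hl₀ : c.entry = some l₀) :
    ∃ code : List Instr, ∀ (S S' : Store Γ) (t : ℕ) (s : ℕ → List ℕ), RunsWithin c S t S' →
      Represents κ τ s S →
      code.length ≤ ((step code)^[t] ⟨0, s⟩).pc ∧
        Represents κ τ ((step code)^[t] ⟨0, s⟩).stk S' := by
  classical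
  have : Fintype c.Label := Fintype.ofFinite _
  -- Execution starts at instruction 0, so the entry label is put first. It occurs again later,
  -- which is harmless since `idxOf` returns the first occurrence. The exit gets the address
  -- `ls.length`, beyond the last instruction.
  let ls : List c.Label := l₀ :: Finset.univ.toList
  have hls : ∀ l, l ∈ ls := fun l => by simp [ls]
  let addr : Option c.Label → ℕ := fun o => o.elim ls.length fun l => ls.idxOf l
  let code := ls.map fun l => (Cmd.flow l).toInstr κ τ hτ addr
  have hlen : code.length = ls.length := by simp [code]
  have hcode : ∀ l, code[addr (some l)]? = some ((Cmd.flow l).toInstr κ τ hτ addr) := fun l => by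
    simp only [code, List.getElem?_map, addr, Option.elim]
    rw [List.getElem?_idxOf (hls l)]
    rfl
  have hstep : ∀ (o : Option c.Label) (S : Store Γ) (s : ℕ → List ℕ), Represents κ τ s S →
      ∃ s', step code ⟨addr o, s⟩ = ⟨addr (flowStep Cmd.flow (o, S)).1, s'⟩ ∧
        Represents κ τ s' (flowStep Cmd.flow (o, S)).2 := by
    intro o S s hs
    cases o with
    | none =>
      refine ⟨s, ?_, hs⟩
      have : code[addr none]? = none := by simp [addr, hlen]
      simp only [step, this, flowStep]
    | some l =>
      simp only [step, hcode, flowStep]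
      cases hf : Cmd.flow l with
      | push k a next =>
        refine ⟨_, rfl, ?_⟩
        have := hs.update hκ k (a :: S k)
        rw [hs k]
        exact this
      | pop k e f =>
        simp only [FlowOp.toInstr, FlowOp.exec, hs k]
        cases hk : S k with
        | nil => exact ⟨s, rfl, hs⟩
        | cons a r =>
          refine ⟨_, ?_, hs.update hκ k r⟩
          simp only [List.map_cons]
          rw [(exists_jumpTable (τ k) (hτ k) fun a => addr (f a)).choose_spec]
  have hiter : ∀ (n : ℕ) (o : Option c.Label) (S : Store Γ) (s : ℕ → List ℕ),
      Represents κ τ s S → ∃ s', (step code)^[n] ⟨addr o, s⟩ =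
        ⟨addr ((flowStep Cmd.flow)^[n] (o, S)).1, s'⟩ ∧
        Represents κ τ s' ((flowStep Cmd.flow)^[n] (o, S)).2 := by
    intro n
    induction n with
    | zero => exact fun o S s hs => ⟨s, rfl, hs⟩
    | succ n ih =>
      intro o S s hs
      obtain ⟨s', h1, h2⟩ := hstep o S s hs
      obtain ⟨s'', h3, h4⟩ := ih (flowStep Cmd.flow (o, S)).1 (flowStep Cmd.flow (o, S)).2 s' h2
      exact ⟨s'', by rw [Function.iterate_succ_apply, Function.iterate_succ_apply, h1, h3], h4⟩
  refine ⟨code, ?_⟩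
  rintro S S' t s ⟨n, hn, hr⟩ hs
  -- A halted flow graph no longer changes, so a bound on the running time suffices to know the
  -- configuration after exactly `t` steps.
  have hflow : (flowStep Cmd.flow)^[t] (c.entry, S) = (none, S') := by
    obtain ⟨m, rfl⟩ := Nat.exists_eq_add_of_le hn
    exact iterate_trans hr.flow_self (Function.iterate_fixed rfl m)
  obtain ⟨s', h1, h2⟩ := hiter t c.entry S s hs
  have h0 : addr c.entry = 0 := by simp [addr, hl₀, ls]
  rw [hflow] at h1 h2
  rw [h0] at h1
  rw [h1]
  exact ⟨hlen.le, h2⟩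

end Instructions

instance : Finite Symbol :=
  Finite.of_surjective (α := Bool × Bool)
    (fun | (false, false) => .zero | (false, true) => .one | (true, false) => .lpar
         | (true, true) => .rpar)
    (fun
      | .zero => ⟨(false, false), rfl⟩ | .one => ⟨(false, true), rfl⟩
      | .lpar => ⟨(true, false), rfl⟩ | .rpar => ⟨(true, true), rfl⟩)

/-! ### Turing machines as programs -/

/-- The symbols, with their stacks, that a statement may push. -/
def pushedSymbols {K : Type} {Γ : K → Type} {Λ σ : Type} : TM2.Stmt Γ Λ σ → Set (Σ k, Γ k)
  | .push k f q => Set.range (fun v => ⟨k, f v⟩) ∪ pushedSymbols q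
  | .peek _ _ q => pushedSymbols q
  | .pop _ _ q => pushedSymbols q
  | .load _ q => pushedSymbols q
  | .branch _ q r => pushedSymbols q ∪ pushedSymbols r
  | .goto _ => ∅
  | .halt => ∅

/-- A pushed symbol is a function of the internal state, which has finitely many values. This
matters because a `FinTM2` may have infinite alphabets on stacks other than the input stack, while
programs with finitely many labels need finite ones. -/
theorem finite_pushedSymbols {K : Type} {Γ : K → Type} {Λ σ : Type} [Finite σ]
    (q : TM2.Stmt Γ Λ σ) : (pushedSymbols q).Finite := by
  induction q with
  | push k f q ih => exact (Set.finite_range _).union ih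
  | peek _ _ q ih => exact ih
  | pop _ _ q ih => exact ih
  | load _ q ih => exact ih
  | branch _ q r ihq ihr => exact ihq.union ihr
  | goto _ => exact Set.finite_empty
  | halt => exact Set.finite_empty

/-- A bound for the number of elementary operations in a statement. -/
def stmtSize {K : Type} {Γ : K → Type} {Λ σ : Type} : TM2.Stmt Γ Λ σ → ℕ
  | .push _ _ q => 1 + stmtSize q
  | .peek _ _ q => 1 + (1 + stmtSize q)
  | .pop _ _ q => 1 + stmtSize q
  | .load _ q => stmtSize q
  | .branch _ q r => stmtSize q + stmtSize r
  | .goto _ => 1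
  | .halt => 0

section Simulation

variable (tm : FinTM2)

/-- The symbols that can occur on the stacks of a machine during its computations. -/
def usedSymbols : Set (Σ k, tm.Γ k) :=
  Set.range (fun a : tm.Γ tm.k₀ => ⟨tm.k₀, a⟩) ∪ ⋃ l, pushedSymbols (tm.m l)

theorem finite_usedSymbols : (usedSymbols tm).Finite := by
  have := tm.Γk₀Fin
  have := tm.ΛFin
  have := tm.σFin
  exact (Set.finite_range _).union (Set.finite_iUnion fun l => finite_pushedSymbols _)

/-- A finite alphabet for stack `k` of a machine. -/
abbrev UsedSymbol (k : tm.K) : Type := Option {a : tm.Γ k // ⟨k, a⟩ ∈ usedSymbols tm}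

instance (k : tm.K) : Finite (UsedSymbol tm k) := by
  have : Finite {a : tm.Γ k // ⟨k, a⟩ ∈ usedSymbols tm} :=
    ((finite_usedSymbols tm).preimage (f := Sigma.mk k) sigma_mk_injective.injOn).to_subtype
  infer_instance

open Classical in
/-- The representation of a symbol in the finite alphabet. -/
noncomputable def toUsed (k : tm.K) (a : tm.Γ k) : UsedSymbol tm k :=
  if h : ⟨k, a⟩ ∈ usedSymbols tm then some ⟨a, h⟩ else none

theorem map_val_toUsed {k : tm.K} {a : tm.Γ k} (h : ⟨k, a⟩ ∈ usedSymbols tm) :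
    (toUsed tm k a).map Subtype.val = some a := by
  simp [toUsed, h]

/-- The stacks that are used in addition to those of the simulated machine. -/
inductive Reg
  | sched
  | data
  | out
  | cnt
  | tmp
  | ctl
  deriving DecidableEq

/-- The alphabets of the simulating program. The stack `ctl` holds the current label and internal
state of the simulated machine. -/
abbrev SimΓ : Reg ⊕ tm.K → Type
  | .inl .sched => Symbol
  | .inl .data => Bool
  | .inl .out => Symbol
  | .inl .cnt => Unit
  | .inl .tmp => Bool
  | .inl .ctl => tm.Λ × tm.σ
  | .inr k => UsedSymbol tm k

instance finite_simΓ : ∀ k, Finite (SimΓ tm k)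
  | .inl .sched => inferInstanceAs (Finite Symbol)
  | .inl .data => inferInstanceAs (Finite Bool)
  | .inl .out => inferInstanceAs (Finite Symbol)
  | .inl .cnt => inferInstanceAs (Finite Unit)
  | .inl .tmp => inferInstanceAs (Finite Bool)
  | .inl .ctl =>
    have := tm.ΛFin
    have := tm.σFin
    inferInstanceAs (Finite (tm.Λ × tm.σ))
  | .inr k => inferInstanceAs (Finite (UsedSymbol tm k))

variable {tm}

/-- The store of the simulating program with the given contents. -/
def simStore (sched : List Symbol) (data : List Bool) (out : List Symbol) (cnt : List Unit)
    (tmp : List Bool) (ctl : List (tm.Λ × tm.σ)) (T : ∀ k, List (UsedSymbol tm k)) :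
    Store (SimΓ tm)
  | .inl .sched => sched
  | .inl .data => data
  | .inl .out => out
  | .inl .cnt => cnt
  | .inl .tmp => tmp
  | .inl .ctl => ctl
  | .inr k => T k

section update

variable (s : List Symbol) (d : List Bool) (o : List Symbol) (n : List Unit)
    (t : List Bool) (c : List (tm.Λ × tm.σ)) (T : ∀ k, List (UsedSymbol tm k))

theorem update_sched (l : List Symbol) :
    Function.update (simStore s d o n t c T) (.inl .sched) l = simStore l d o n t c T := by
  funext k; rcases k with (_ | _) | _ <;> rfl

theorem update_data (l : List Bool) :
    Function.update (simStore s d o n t c T) (.inl .data) l = simStore s l o n t c T := by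
  funext k; rcases k with (_ | _) | _ <;> rfl

theorem update_out (l : List Symbol) :
    Function.update (simStore s d o n t c T) (.inl .out) l = simStore s d l n t c T := by
  funext k; rcases k with (_ | _) | _ <;> rfl

theorem update_cnt (l : List Unit) :
    Function.update (simStore s d o n t c T) (.inl .cnt) l = simStore s d o l t c T := by
  funext k; rcases k with (_ | _) | _ <;> rfl

theorem update_tmp (l : List Bool) :
    Function.update (simStore s d o n t c T) (.inl .tmp) l = simStore s d o n l c T := by
  funext k; rcases k with (_ | _) | _ <;> rfl

theorem update_ctl (l : List (tm.Λ × tm.σ)) :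
    Function.update (simStore s d o n t c T) (.inl .ctl) l = simStore s d o n t l T := by
  funext k; rcases k with (_ | _) | _ <;> rfl

theorem update_inr (k : tm.K) (l : List (UsedSymbol tm k)) :
    Function.update (simStore s d o n t c T) (.inr k) l =
      simStore s d o n t c (Function.update T k l) := by
  funext j
  rcases j with (_ | _) | j
  iterate 6 rfl
  by_cases hj : j = k
  · subst hj; simp [simStore]
  · have : (Sum.inr j : Reg ⊕ tm.K) ≠ Sum.inr k := by simpa using hj
    rw [Function.update_of_ne this]
    simp [simStore, hj]

end update

/-- The stacks of the simulated machine, in the finite alphabets. -/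
noncomputable def usedStacks (S : ∀ k, List (tm.Γ k)) (k : tm.K) : List (UsedSymbol tm k) :=
  (S k).map (toUsed tm k)

theorem usedStacks_update (S : ∀ k, List (tm.Γ k)) (k : tm.K) (l : List (tm.Γ k)) :
    usedStacks (Function.update S k l) =
      Function.update (usedStacks S) k (l.map (toUsed tm k)) := by
  funext j
  by_cases hj : j = k
  · subst hj; simp [usedStacks]
  · simp [usedStacks, hj]

/-- All symbols on the stacks belong to the finite alphabets. -/
def AllUsed (S : ∀ k, List (tm.Γ k)) : Prop := ∀ k, ∀ a ∈ S k, ⟨k, a⟩ ∈ usedSymbols tm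

theorem AllUsed.update {S : ∀ k, List (tm.Γ k)} (hS : AllUsed S) {k : tm.K}
    {l : List (tm.Γ k)} (hl : ∀ a ∈ l, ⟨k, a⟩ ∈ usedSymbols tm) :
    AllUsed (Function.update S k l) := by
  intro j
  by_cases hj : j = k
  · subst hj; simpa using hl
  · simpa [hj] using hS j

/-- The program for a statement of the simulated machine in the internal state `v`. -/
noncomputable def stmtCmd : TM2.Stmt tm.Γ tm.Λ tm.σ → tm.σ → Cmd (SimΓ tm)
  | .push k f q, v => .seq (.push (.inr k) (toUsed tm k (f v))) (stmtCmd q v)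
  | .peek k f q, v =>
    .pop (.inr k) (stmtCmd q (f v none))
      fun a => .seq (.push (.inr k) a) (stmtCmd q (f v (a.map Subtype.val)))
  | .pop k f q, v =>
    .pop (.inr k) (stmtCmd q (f v none)) fun a => stmtCmd q (f v (a.map Subtype.val))
  | .load a q, v => stmtCmd q (a v)
  | .branch f q r, v => cond (f v) (stmtCmd q v) (stmtCmd r v)
  | .goto f, v => .push (.inl .ctl) (f v, v)
  | .halt, _ => .skip

/-- The control stack for a configuration. -/
def ctlStack (C : TM2.Cfg tm.Γ tm.Λ tm.σ) : List (tm.Λ × tm.σ) :=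
  C.l.elim [] fun l => [(l, C.var)]

/-- The internal state is a parameter of the program, so `load` and `branch` cost nothing. The
control stack is empty at the start and is refilled only by `goto`; after `halt` it stays empty,
which ends the main loop. `AllUsed` is carried along because `toUsed` can be inverted only on used
symbols. -/
theorem runsWithin_stmtCmd (s : List Symbol) (d : List Bool) (o : List Symbol) (n : List Unit)
    (t : List Bool) (q : TM2.Stmt tm.Γ tm.Λ tm.σ) (hq : pushedSymbols q ⊆ usedSymbols tm)
    (v : tm.σ) (S : ∀ k, List (tm.Γ k)) (hS : AllUsed S) :
    AllUsed (TM2.stepAux q v S).stk ∧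
    RunsWithin (stmtCmd q v) (simStore s d o n t [] (usedStacks S)) (stmtSize q)
      (simStore s d o n t (ctlStack (TM2.stepAux q v S))
        (usedStacks (TM2.stepAux q v S).stk)) := by
  induction q generalizing v S with
  | push k f q ih =>
    have hq' : ∀ v, ⟨k, f v⟩ ∈ usedSymbols tm := fun v => hq (.inl ⟨v, rfl⟩)
    obtain ⟨h1, h2⟩ := ih (fun _ h => hq (.inr h)) v (Function.update S k (f v :: S k))
      (hS.update (by
        intro a ha
        rcases List.mem_cons.1 ha with rfl | ha
        · exact hq' v
        · exact hS k a ha))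
    refine ⟨h1, ((Runs.push _ _ _).within).seq ?_⟩
    rw [update_inr]
    rw [usedStacks_update] at h2
    exact h2
  | peek k f q ih =>
    simp only [TM2.stepAux, stmtCmd]
    cases hk : S k with
    | nil =>
      obtain ⟨h1, h2⟩ := ih hq (f v none) S hS
      exact ⟨h1, (h2.pop_nil (by simp [simStore, usedStacks, hk])).mono
        (by simp [stmtSize])⟩
    | cons a r =>
      obtain ⟨h1, h2⟩ := ih hq (f v (some a)) S hS
      refine ⟨h1, RunsWithin.pop_cons (a := toUsed tm k a) (r := r.map (toUsed tm k))
        (by simp [simStore, usedStacks, hk]) ((Runs.push _ _ _).within.seq ?_)⟩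
      rw [map_val_toUsed tm (hS k a (by simp [hk])), update_inr, update_inr]
      simp only [List.head?_cons]
      convert h2 using 2
      funext j
      by_cases hj : j = k
      · subst hj; simp [usedStacks, hk, simStore]
      · simp [hj]
  | pop k f q ih =>
    simp only [TM2.stepAux, stmtCmd]
    cases hk : S k with
    | nil =>
      have hS' : Function.update S k [] = S := by rw [← hk, Function.update_eq_self]
      obtain ⟨h1, h2⟩ := ih hq (f v none) S hS
      simp only [List.head?_nil, List.tail_nil, hS']
      exact ⟨h1, h2.pop_nil (by simp [simStore, usedStacks, hk])⟩
    | cons a r =>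
      obtain ⟨h1, h2⟩ := ih hq (f v (some a)) (Function.update S k r)
        (hS.update fun b hb => hS k b (by simp [hk, hb]))
      refine ⟨h1, RunsWithin.pop_cons (a := toUsed tm k a) (r := r.map (toUsed tm k))
        (by simp [simStore, usedStacks, hk]) ?_⟩
      rw [map_val_toUsed tm (hS k a (by simp [hk])), update_inr, ← usedStacks_update]
      exact h2
  | load a q ih => exact ih hq (a v) S hS
  | branch f q r ihq ihr =>
    simp only [TM2.stepAux, stmtCmd]
    cases f v with
    | true =>
      obtain ⟨h1, h2⟩ := ihq (fun _ h => hq (.inl h)) v S hS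
      exact ⟨h1, h2.mono (Nat.le_add_right _ _)⟩
    | false =>
      obtain ⟨h1, h2⟩ := ihr (fun _ h => hq (.inr h)) v S hS
      exact ⟨h1, h2.mono (Nat.le_add_left _ _)⟩
  | goto f =>
    refine ⟨hS, ?_⟩
    have := (Runs.push (simStore s d o n t [] (usedStacks S)) (.inl .ctl) (f v, v)).within
    rw [update_ctl] at this
    exact this
  | halt => exact ⟨hS, (Runs.skip _).within⟩

/-- The main loop of the simulation. -/
noncomputable def simLoop (tm : FinTM2) : Cmd (SimΓ tm) :=
  .loop (.inl .ctl) fun p => stmtCmd (tm.m p.1) p.2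

/-- The simulation takes a bounded number of operations for each step of the machine. -/
theorem exists_runsWithin_simLoop (tm : FinTM2) :
    ∃ c : ℕ, ∀ (s : List Symbol) (d : List Bool) (o : List Symbol) (n : List Unit)
      (t : List Bool) (m : ℕ) (C : tm.Cfg) (v : tm.σ) (S' : ∀ k, List (tm.Γ k)), AllUsed C.stk →
      (flip bind tm.step)^[m] (some C) = some ⟨none, v, S'⟩ →
      AllUsed S' ∧ RunsWithin (simLoop tm) (simStore s d o n t (ctlStack C) (usedStacks C.stk)) (c * m + 1)
        (simStore s d o n t [] (usedStacks S')) := by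
  have := tm.ΛFin
  -- One operation pops the control stack; the rest bounds the longest statement.
  refine ⟨1 + Finset.univ.sup fun l => stmtSize (tm.m l), ?_⟩
  intro s d o n t m
  induction m with
  | zero =>
    intro C v S' hC h
    obtain rfl : C = ⟨none, v, S'⟩ := Option.some.inj h
    exact ⟨hC, (Runs.loop_nil rfl).within⟩
  | succ m ih =>
    rintro ⟨l, w, S⟩ v S' hC h
    rw [Function.iterate_succ_apply] at h
    cases l with
    | none =>
      exfalso
      -- A halted machine steps to `none` rather than to itself, so it reaches no configuration
      -- after a further step.
      have hfix : ∀ m, (flip bind tm.step)^[m] none = none := fun m =>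
        Function.iterate_fixed rfl m
      have h' : (flip bind tm.step)^[m] none = some ⟨none, v, S'⟩ := h
      rw [hfix] at h'
      cases h'
    | some l =>
      obtain ⟨h1, h2⟩ := runsWithin_stmtCmd s d o n t (tm.m l)
        (fun _ h => .inr (Set.mem_iUnion.2 ⟨l, h⟩)) w S hC
      obtain ⟨hS', h3⟩ := ih (TM2.stepAux (tm.m l) w S) v S' h1 h
      have hl : stmtSize (tm.m l) ≤ Finset.univ.sup fun l => stmtSize (tm.m l) :=
        Finset.le_sup (f := fun l => stmtSize (tm.m l)) (Finset.mem_univ l)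
      refine ⟨hS', (RunsWithin.loop_cons (a := (l, w)) (r := []) rfl ?_ h3).mono
        (t := 1 + (stmtSize (tm.m l) + _)) (by rw [Nat.mul_succ]; omega)⟩
      rw [update_ctl]
      exact h2

end Simulation

/-! ### Printing strings with unary polynomials -/

/-- The stacks of the printing program. -/
inductive PrintReg
  | inp
  | out
  | tmp
  | acc
  | aux
  deriving DecidableEq

instance : Fintype PrintReg :=
  ⟨{.inp, .out, .tmp, .acc, .aux}, fun r => by cases r <;> decide⟩

/-- The alphabets of the printing program. -/
abbrev PrintΓ : PrintReg → Type
  | .inp => Bool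
  | .out => Symbol
  | .tmp => Bool
  | .acc => Unit
  | .aux => Unit

instance finite_printΓ : ∀ k, Finite (PrintΓ k)
  | .inp => inferInstanceAs (Finite Bool)
  | .out => inferInstanceAs (Finite Symbol)
  | .tmp => inferInstanceAs (Finite Bool)
  | .acc => inferInstanceAs (Finite Unit)
  | .aux => inferInstanceAs (Finite Unit)

/-- The store of the printing program with the given contents, the last two of them in unary. -/
def printStore (x : List Bool) (o : List Symbol) (t : List Bool) (a b : ℕ) : Store PrintΓ
  | .inp => x
  | .out => o
  | .tmp => t
  | .acc => List.replicate a ()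
  | .aux => List.replicate b ()

section update

variable (x : List Bool) (o : List Symbol) (t : List Bool) (a b : ℕ)

theorem update_inp (l : List Bool) :
    Function.update (printStore x o t a b) .inp l = printStore l o t a b := by
  funext k; cases k <;> rfl

theorem update_print (l : List Symbol) :
    Function.update (printStore x o t a b) .out l = printStore x l t a b := by
  funext k; cases k <;> rfl

theorem update_copy (l : List Bool) :
    Function.update (printStore x o t a b) .tmp l = printStore x o l a b := by
  funext k; cases k <;> rfl

theorem update_acc (l : List Unit) :
    Function.update (printStore x o t a b) .acc l = printStore x o t l.length b := by
  funext k; cases k <;> first | rfl | exact List.eq_replicate_of_mem (fun _ _ => rfl)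

theorem update_aux (l : List Unit) :
    Function.update (printStore x o t a b) .aux l = printStore x o t a l.length := by
  funext k; cases k <;> first | rfl | exact List.eq_replicate_of_mem (fun _ _ => rfl)

end update

theorem flatMap_pure {α : Type} (l : List α) : (l.flatMap fun a => [a]) = l := by
  simp

/-- This is one pass over the input, adding its length to `aux`. The input is kept in reverse on
`tmp`, from where `runsWithin_restore` brings it back. -/
theorem runsWithin_loop_inp (x : List Bool) (o : List Symbol) (t : List Bool) (a b : ℕ) :
    RunsWithin (.loop .inp fun s => .seq (.push .tmp s) (.push .aux ())) (printStore x o t a b)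
      (3 * x.length + 1) (printStore [] o (x.reverse ++ t) a (b + x.length)) := by
  induction x generalizing t b with
  | nil => exact (Runs.loop_nil rfl).within
  | cons s x ih =>
    have h1 := (Runs.push (printStore x o t a b) .tmp s).within.seq (Runs.push _ .aux ()).within
    rw [update_copy, update_aux] at h1
    have h2 := h1.congr (update_inp (s :: x) o t a b x)
      (R' := printStore x o (s :: t) a (b + 1))
      (congrArg (printStore x o (s :: t) a) (congrArg Nat.succ List.length_replicate)) le_rfl
    refine (RunsWithin.loop_cons (S := printStore (s :: x) o t a b) rfl h2
      (ih (s :: t) (b + 1))).congr rfl ?_ ?_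
    · rw [List.reverse_cons, List.append_assoc, List.length_cons]
      exact congrArg _ (by omega)
    · rw [List.length_cons]; omega

/-- Multiplication of `acc` by the length of the input. -/
def mulCmd : Cmd PrintΓ :=
  .seq
    (.loop .acc fun _ => .seq (.loop .inp fun s => .seq (.push .tmp s) (.push .aux ()))
      (.loop .tmp fun s => .pushAll .inp [s]))
    (.loop .aux fun _ => .pushAll .acc [()])

theorem runsWithin_restore (x : List Bool) (o : List Symbol) (a b : ℕ) :
    RunsWithin (.loop .tmp fun s => .pushAll .inp [s]) (printStore [] o (x.reverse) a b)
      (2 * x.length + 1) (printStore x o [] a b) := by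
  have h := runs_loop_pushAll (Γ := PrintΓ) (k := .tmp) (k' := .inp) (by decide)
    (fun s => [s]) 1 (by simp) x.reverse (printStore [] o x.reverse a b) rfl
  rw [update_copy, update_inp, flatMap_pure, List.reverse_reverse, List.length_reverse] at h
  exact h.congr rfl (congrArg (printStore · o [] a b) (List.append_nil x)) le_rfl

/-- Each unit of `acc` pays for one pass over the input and its restoration, `5 * x.length + 3`
operations in all. Moving the product from `aux` back to `acc` costs two operations per unit. -/
theorem runsWithin_mulCmd (x : List Bool) (o : List Symbol) (a : ℕ) :
    RunsWithin mulCmd (printStore x o [] a 0) (a * (7 * x.length + 3) + 2)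
      (printStore x o [] (a * x.length) 0) := by
  have h1 : ∀ a b, RunsWithin (.loop .acc fun _ => .seq (.loop .inp fun s => .seq (.push .tmp s)
      (.push .aux ())) (.loop .tmp fun s => .pushAll .inp [s])) (printStore x o [] a b)
      (a * (5 * x.length + 3) + 1) (printStore x o [] 0 (b + a * x.length)) := by
    intro a
    induction a with
    | zero =>
      intro b
      exact (Runs.loop_nil rfl).within.congr rfl (by simp) (by simp)
    | succ a ih =>
      intro b
      have h2 := runsWithin_loop_inp x o [] a b
      rw [List.append_nil] at h2
      have h3 := h2.seq (runsWithin_restore x o a (b + x.length))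
      refine (RunsWithin.loop_cons (S := printStore x o [] (a + 1) b) (a := ())
        (r := List.replicate a ()) rfl (h3.congr ?_ rfl le_rfl) (ih _)).congr rfl ?_ ?_
      · rw [update_acc, List.length_replicate]
      · exact congrArg _ (by ring)
      · ring_nf; omega
  have h2 := runs_loop_pushAll (Γ := PrintΓ) (k := .aux) (k' := .acc) (by decide)
    (fun _ => [()]) 1 (by simp) (List.replicate (a * x.length) ())
    (printStore x o [] 0 (a * x.length)) rfl
  rw [update_aux, update_acc] at h2
  refine ((h1 a 0).seq (h2.congr (by rw [Nat.zero_add]) rfl le_rfl)).congr rfl ?_ ?_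
  · refine congrArg (printStore x o [] · 0) ?_
    rw [flatMap_pure, List.reverse_replicate]
    change (List.replicate (a * x.length) () ++ []).length = _
    simp
  · rw [List.length_replicate]; ring_nf; omega

/-- Every polynomial in the length of the input can be evaluated in unary. -/
theorem exists_evalCmd (p : Polynomial ℕ) : ∃ (c : Cmd PrintΓ) (T : Polynomial ℕ),
    ∀ (x : List Bool) (o : List Symbol), RunsWithin c (printStore x o [] 0 0)
      (T.eval x.length) (printStore x o [] (p.eval x.length) 0) := by
  -- By Horner's scheme only two operations on `acc` are needed: adding a constant and multiplying
  -- by the length of the input.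
  induction p using Polynomial.recOnHorner with
  | M0 => exact ⟨.skip, 0, fun x o => by simpa using (Runs.skip _).within⟩
  | MC p a _ _ ih =>
    obtain ⟨c, T, h⟩ := ih
    refine ⟨.seq c (.pushAll .acc (List.replicate a ())), T + Polynomial.C a, fun x o => ?_⟩
    have h1 := (runs_pushAll (Γ := PrintΓ) .acc (List.replicate a ())
      (printStore x o [] (p.eval x.length) 0)).within
    rw [update_acc] at h1
    refine ((h x o).seq h1).congr rfl ?_ ?_
    · refine congrArg (printStore x o [] · 0) ?_
      change (List.replicate a () ++ List.replicate (p.eval x.length) ()).length = _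
      simp [Nat.add_comm]
    · simp
  | MX p _ ih =>
    obtain ⟨c, T, h⟩ := ih
    refine ⟨.seq c mulCmd, T + (p * (7 * Polynomial.X + 3) + 2), fun x o => ?_⟩
    exact ((h x o).seq (runsWithin_mulCmd x o _)).congr rfl (by simp) (by simp)

/-- Printing a unary number. -/
theorem exists_printCmd (p : Polynomial ℕ) : ∃ (c : Cmd PrintΓ) (T : Polynomial ℕ),
    ∀ (x : List Bool) (o : List Symbol), RunsWithin c (printStore x o [] 0 0)
      (T.eval x.length) (printStore x (encUnary (p.eval x.length) ++ o) [] 0 0) := by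
  obtain ⟨c, T, h⟩ := exists_evalCmd p
  refine ⟨.seq (.pushAll .out [.rpar]) (.seq c
    (.seq (.loop .acc fun _ => .pushAll .out [.one]) (.pushAll .out [.lpar]))),
    1 + (T + ((2 * p + 1) + 1)), fun x o => ?_⟩
  have h1 := (runs_pushAll (Γ := PrintΓ) .out [.rpar] (printStore x o [] 0 0)).within
  rw [update_print] at h1
  have h2 := h x (.rpar :: o)
  have h3 := runs_loop_pushAll (Γ := PrintΓ) (k := .acc) (k' := .out) (by decide)
    (fun _ => [.one]) 1 (by simp) (List.replicate (p.eval x.length) ())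
    (printStore x (.rpar :: o) [] (p.eval x.length) 0) rfl
  rw [update_acc, update_print] at h3
  have h4 := (runs_pushAll (Γ := PrintΓ) .out [.lpar] (printStore x
    (List.replicate (p.eval x.length) .one ++ .rpar :: o) [] 0 0)).within
  rw [update_print] at h4
  refine (h1.seq (h2.seq ((h3.congr rfl ?_ le_rfl).seq h4))).congr rfl ?_ ?_
  · refine congrArg (printStore x · [] 0 0) ?_
    rw [List.reverse_replicate, ← List.map_eq_flatMap, List.map_replicate]
    rfl
  · refine congrArg (printStore x · [] 0 0) ?_
    change .lpar :: (List.replicate (p.eval x.length) .one ++ .rpar :: o) = _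
    simp [encUnary, encBits, encBit]
  · simp

/-- Strings that consist of constant parts, unary polynomials and the input can be printed in
polynomial time. -/
theorem polyTime_print (u v : List Symbol) (p q : Polynomial ℕ) :
    Nonempty (TM2ComputableInPolyTime (id : List Bool → _) (id : List Symbol → _)
      fun x => u ++ (encUnary (p.eval x.length) ++
        (v ++ (encBits x ++ encUnary (q.eval x.length))))) := by
  obtain ⟨cp, Tp, hp⟩ := exists_printCmd p
  obtain ⟨cq, Tq, hq⟩ := exists_printCmd q
  let copy : Cmd PrintΓ := .seq (.pushAll .out [.rpar]) (.seq
    (.loop .inp fun s => .pushAll .tmp [s]) (.seq (.loop .tmp fun s =>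
      .seq (.push .inp s) (.push .out (encBit s))) (.pushAll .out [.lpar])))
  have hcopy : ∀ (x : List Bool) (o : List Symbol), RunsWithin copy (printStore x o [] 0 0)
      (1 + ((2 * x.length + 1) + ((3 * x.length + 1) + 1)))
      (printStore x (encBits x ++ o) [] 0 0) := by
    intro x o
    have h1 := (runs_pushAll (Γ := PrintΓ) .out [.rpar] (printStore x o [] 0 0)).within
    rw [update_print] at h1
    have h2 := runs_loop_pushAll (Γ := PrintΓ) (k := .inp) (k' := .tmp) (by decide)
      (fun s => [s]) 1 (by simp) x (printStore x (.rpar :: o) [] 0 0) rfl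
    rw [update_inp, update_copy, flatMap_pure] at h2
    have h3 : ∀ (t x : List Bool) (o : List Symbol), RunsWithin (.loop .tmp fun s =>
        .seq (.push .inp s) (.push .out (encBit s))) (printStore x o t 0 0) (3 * t.length + 1)
        (printStore (t.reverse ++ x) ((t.reverse.map encBit) ++ o) [] 0 0) := by
      intro t
      induction t with
      | nil => exact fun x o => (Runs.loop_nil rfl).within
      | cons s t ih =>
        intro x o
        have h1 := (Runs.push (printStore x o t 0 0) .inp s).within.seq
          (Runs.push _ .out (encBit s)).within
        rw [update_inp, update_print] at h1
        refine (RunsWithin.loop_cons (S := printStore x o (s :: t) 0 0) rfl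
          (h1.congr (update_copy ..) rfl le_rfl) (ih _ _)).congr rfl ?_ ?_
        · rw [List.reverse_cons, List.map_append, List.append_assoc, List.append_assoc]
          rfl
        · rw [List.length_cons]; omega
    have h4 := h3 x.reverse [] (.rpar :: o)
    rw [List.reverse_reverse, List.length_reverse, List.append_nil] at h4
    have h5 := (runs_pushAll (Γ := PrintΓ) .out [.lpar]
      (printStore x (x.map encBit ++ .rpar :: o) [] 0 0)).within
    rw [update_print] at h5
    refine (h1.seq ((h2.congr rfl ?_ le_rfl).seq (h4.seq h5))).congr rfl ?_ le_rfl
    · exact congrArg (printStore [] (.rpar :: o) · 0 0) (List.append_nil _)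
    · refine congrArg (printStore x · [] 0 0) ?_
      change .lpar :: (x.map encBit ++ .rpar :: o) = _
      simp [encBits]
  -- The output is a stack, so the pieces are printed from the last to the first. The final loop
  -- only erases the input, since nothing but the result may remain.
  let main : Cmd PrintΓ := .seq cq (.seq copy (.seq (.pushAll .out v) (.seq cp
    (.seq (.pushAll .out u) (.loop .inp fun _ => .pushAll .tmp [])))))
  refine polyTime_of_runsWithin main .inp .out
    (Tq + ((1 + ((2 * Polynomial.X + 1) + ((3 * Polynomial.X + 1) + 1))) +
      (Polynomial.C v.length + (Tp + (Polynomial.C u.length + (Polynomial.X + 1)))))) _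
    fun x => ?_
  have h0 : ∀ x, (Store.single .inp x : Store PrintΓ) = printStore x [] [] 0 0 := fun x => by
    funext k; cases k <;> rfl
  have h0' : ∀ o, (Store.single .out o : Store PrintΓ) = printStore [] o [] 0 0 := fun x => by
    funext k; cases k <;> rfl
  have h1 := (runs_pushAll (Γ := PrintΓ) .out v
    (printStore x (encBits x ++ (encUnary (q.eval x.length) ++ [])) [] 0 0)).within
  have h2 := (runs_pushAll (Γ := PrintΓ) .out u
    (printStore x (encUnary (p.eval x.length) ++
      (v ++ (encBits x ++ (encUnary (q.eval x.length) ++ [])))) [] 0 0)).within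
  have h3 := runs_loop_pushAll (Γ := PrintΓ) (k := .inp) (k' := .tmp) (by decide)
    (fun _ => []) 0 (by simp) x (printStore x (u ++ (encUnary (p.eval x.length) ++
      (v ++ (encBits x ++ (encUnary (q.eval x.length) ++ []))))) [] 0 0) rfl
  rw [update_print] at h1 h2
  rw [update_inp, update_copy] at h3
  refine ((hq x []).seq ((hcopy x _).seq (h1.seq ((hp x _).seq (h2.seq h3))))).congr
    (h0 x) ?_ ?_
  · rw [h0', List.append_nil]
    refine congrArg (printStore [] _ · 0 0) ?_
    change List.flatMap (fun _ => []) x.reverse ++ [] = []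
    simp
  · simp

/-! ### Unique readability -/

/-- No code word is a proper prefix of another one, and different objects have different codes. -/
def SelfDelimiting {α : Type} (f : α → List Symbol) : Prop :=
  ∀ a b r s, f a ++ r = f b ++ s → a = b ∧ r = s

/-- No code word starts with a closing parenthesis or is empty. -/
def ProperStart {α : Type} (f : α → List Symbol) : Prop :=
  ∀ a, ∃ h t, f a = h :: t ∧ h ≠ Symbol.rpar

theorem SelfDelimiting.injective {α : Type} {f : α → List Symbol} (hf : SelfDelimiting f) :
    Function.Injective f := fun a b h => (hf a b [] [] (by rw [h])).1

/-- No bit is coded by the closing parenthesis, which therefore marks the end. -/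
theorem encBits_selfDelimiting : SelfDelimiting encBits := by
  intro a b r s h
  induction a generalizing b with
  | nil =>
    cases b with
    | nil => simpa [encBits] using h
    | cons y b => cases y <;> simp [encBits, encBit] at h
  | cons x a ih =>
    cases b with
    | nil => cases x <;> simp [encBits, encBit] at h
    | cons y b =>
      have : x = y ∧ encBits a ++ r = encBits b ++ s := by
        cases x <;> cases y <;> simp [encBits, encBit] at h ⊢ <;> exact h
      obtain ⟨rfl, h'⟩ := this
      obtain ⟨rfl, rfl⟩ := ih b h'
      exact ⟨rfl, rfl⟩

theorem bits_injective : Function.Injective Nat.bits := by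
  intro a
  induction a using Nat.binaryRec' with
  | zero =>
    intro b h
    by_contra hb
    have := congrArg List.length h
    rw [Nat.zero_bits, Nat.size_eq_bits_len, List.length_nil] at this
    exact hb (Nat.size_eq_zero.1 this.symm).symm
  | bit x a hx ih =>
    intro b h
    induction b using Nat.binaryRec' with
    | zero =>
      have := congrArg List.length h
      rw [Nat.zero_bits, Nat.size_eq_bits_len, List.length_nil] at this
      exact Nat.size_eq_zero.1 this
    | bit y b hy _ =>
      rw [Nat.bits_append_bit _ _ hx, Nat.bits_append_bit _ _ hy, List.cons.injEq] at h
      rw [h.1, ih h.2]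

theorem encNat_selfDelimiting : SelfDelimiting encNat := fun _ _ _ _ h =>
  (encBits_selfDelimiting _ _ _ _ h).imp (fun h => bits_injective h) id

theorem encUnary_selfDelimiting : SelfDelimiting encUnary := fun _ _ _ _ h =>
  (encBits_selfDelimiting _ _ _ _ h).imp (fun h => by simpa using congrArg List.length h) id

theorem encInt_selfDelimiting : SelfDelimiting encInt := by
  rintro (a | a) (b | b) r s h
  · simp only [encInt, List.cons_append, List.cons.injEq, true_and] at h
    obtain ⟨rfl, rfl⟩ := encNat_selfDelimiting _ _ _ _ h
    exact ⟨rfl, rfl⟩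
  · simp [encInt] at h
  · simp [encInt] at h
  · simp only [encInt, List.cons_append, List.cons.injEq, true_and] at h
    obtain ⟨rfl, rfl⟩ := encNat_selfDelimiting _ _ _ _ h
    exact ⟨rfl, rfl⟩

/-- `ProperStart` distinguishes a further element from the closing parenthesis of the list;
`SelfDelimiting` then splits off that element. -/
theorem encList_selfDelimiting {α : Type} {f : α → List Symbol} (hf : SelfDelimiting f)
    (hf' : ProperStart f) : SelfDelimiting (encList f) := by
  intro a b r s h
  simp only [encList, List.cons_append, List.cons.injEq, true_and, List.append_assoc,
    List.nil_append] at h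
  induction a generalizing b with
  | nil =>
    cases b with
    | nil => simpa using h
    | cons y b =>
      obtain ⟨c, t, hc, hne⟩ := hf' y
      simp only [List.flatMap_nil, List.nil_append, List.flatMap_cons, hc, List.cons_append,
        List.cons.injEq] at h
      exact absurd h.1.symm hne
  | cons x a ih =>
    cases b with
    | nil =>
      obtain ⟨c, t, hc, hne⟩ := hf' x
      simp only [List.flatMap_nil, List.nil_append, List.flatMap_cons, hc, List.cons_append,
        List.cons.injEq] at h
      exact absurd h.1 hne
    | cons y b =>
      simp only [List.flatMap_cons, List.append_assoc] at h
      obtain ⟨rfl, h'⟩ := hf _ _ _ _ h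
      obtain ⟨rfl, rfl⟩ := ih b h'
      exact ⟨rfl, rfl⟩

theorem encList_properStart {α : Type} (f : α → List Symbol) : ProperStart (encList f) :=
  fun _ => ⟨_, _, rfl, by simp⟩

theorem encNat_properStart : ProperStart encNat := fun _ => ⟨_, _, rfl, by simp⟩

theorem encLoc_selfDelimiting {n : ℕ} {G : BuildingGraph (Fin n)} :
    SelfDelimiting (encLoc (G := G)) := by
  rintro (a | a) (b | b) r s h
  · simp only [encLoc, List.cons_append, List.cons.injEq, true_and] at h
    obtain ⟨h1, rfl⟩ := encNat_selfDelimiting _ _ _ _ h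
    exact ⟨congrArg _ (Fin.ext h1), rfl⟩
  · simp [encLoc] at h
  · simp [encLoc] at h
  · simp only [encLoc, List.cons_append, List.cons.injEq, true_and, List.append_assoc] at h
    obtain ⟨h1, t1⟩ := encNat_selfDelimiting _ _ _ _ h
    obtain ⟨h2, rfl⟩ := encNat_selfDelimiting _ _ _ _ t1
    exact ⟨congrArg _ (Subtype.ext (Prod.ext (Fin.ext h1) (Fin.ext h2))), rfl⟩

theorem encLoc_properStart {n : ℕ} {G : BuildingGraph (Fin n)} :
    ProperStart (encLoc (G := G)) := by
  rintro (a | a) <;> exact ⟨_, _, rfl, by simp⟩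

/-- The number of people is not written in an instance; it is recovered as the length of the list of
locations. -/
theorem encState_unique {n : ℕ} {G : BuildingGraph (Fin n)} {m m' : ℕ} {s : State G (Fin m)}
    {s' : State G (Fin m')} {r r' : List Symbol} (h : encState s ++ r = encState s' ++ r') :
    (⟨m, s⟩ : Σ m, Fin m → G.Loc) = ⟨m', s'⟩ ∧ r = r' :=
  (encList_selfDelimiting encLoc_selfDelimiting encLoc_properStart _ _ _ _ h).imp
    List.ofFn_inj'.1 id

theorem encState_selfDelimiting {n m : ℕ} {G : BuildingGraph (Fin n)} :
    SelfDelimiting (encState (m := m) (G := G)) := fun s s' r r' h =>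
  (encState_unique h).imp (fun h => by simpa using h) id

theorem encSchedule_selfDelimiting {n m tmax : ℕ} {G : BuildingGraph (Fin n)} :
    SelfDelimiting (encSchedule (m := m) (tmax := tmax) (G := G)) := fun _ _ _ _ h =>
  (encList_selfDelimiting encState_selfDelimiting (fun _ => encList_properStart _ _)
    _ _ _ _ h).imp (fun h => List.ofFn_injective h) id

/-- The code of an entry in the list of vertices. -/
def encVertexData (x : Bool × ℤ) : List Symbol := encBit x.1 :: encInt x.2

/-- The code of an entry of the adjacency matrix. -/
def encEdgeData : Option (ℤ × ℤ) → List Symbol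
  | some x => Symbol.one :: (encInt x.1 ++ encInt x.2)
  | none => [Symbol.zero]

theorem encVertexData_selfDelimiting : SelfDelimiting encVertexData := by
  rintro ⟨x, a⟩ ⟨y, b⟩ r s h
  simp only [encVertexData, List.cons_append, List.cons.injEq] at h
  obtain ⟨rfl, rfl⟩ := encInt_selfDelimiting _ _ _ _ h.2
  refine ⟨?_, rfl⟩
  cases x <;> cases y <;> simp_all [encBit]

theorem encVertexData_properStart : ProperStart encVertexData := by
  rintro ⟨x, a⟩
  exact ⟨_, _, rfl, by cases x <;> simp [encBit]⟩

theorem encEdgeData_selfDelimiting : SelfDelimiting encEdgeData := by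
  rintro (_ | ⟨a, b⟩) (_ | ⟨a', b'⟩) r s h
  · simpa [encEdgeData] using h
  · simp [encEdgeData] at h
  · simp [encEdgeData] at h
  · simp only [encEdgeData, List.cons_append, List.cons.injEq, true_and, List.append_assoc] at h
    obtain ⟨rfl, t1⟩ := encInt_selfDelimiting _ _ _ _ h
    obtain ⟨rfl, rfl⟩ := encInt_selfDelimiting _ _ _ _ t1
    exact ⟨rfl, rfl⟩

theorem encEdgeData_properStart : ProperStart encEdgeData := by
  rintro (_ | ⟨a, b⟩) <;> exact ⟨_, _, rfl, by simp⟩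

/-- The entry of the adjacency matrix for a pair of vertices. -/
def edgeData {n : ℕ} (G : BuildingGraph (Fin n)) (u v : Fin n) : Option (ℤ × ℤ) :=
  if h : (u, v) ∈ G.E then some (G.c (Sum.inr ⟨(u, v), h⟩), G.d (Sum.inr ⟨(u, v), h⟩)) else none

/-- Entries depending on membership proofs are replaced by `Option` data, so that the results on
codes of lists apply. -/
theorem encGraph_eq {n : ℕ} (G : BuildingGraph (Fin n)) :
    encGraph G = encList encVertexData
      (List.ofFn fun v => (decide (v ∈ G.EX), G.c (Sum.inl v))) ++
      encList (encList encEdgeData) (List.ofFn fun u => List.ofFn fun v => edgeData G u v) := by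
  simp only [encGraph, encList, List.ofFn_eq_map, List.flatMap_map]
  have : ∀ u v, encEdgeData (edgeData G u v) = if h : (u, v) ∈ G.E then
      Symbol.one :: (encInt (G.c (Sum.inr ⟨(u, v), h⟩)) ++ encInt (G.d (Sum.inr ⟨(u, v), h⟩)))
      else [Symbol.zero] := by
    intro u v
    unfold edgeData
    split <;> rfl
  simp only [this]
  rfl

/-- The number of vertices is the length of the first list. Travel times of vertices are not coded,
but `d_vertex` forces them to be 0. -/
theorem encGraph_unique {n n' : ℕ} {G : BuildingGraph (Fin n)} {G' : BuildingGraph (Fin n')}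
    {r r' : List Symbol} (h : encGraph G ++ r = encGraph G' ++ r') :
    (⟨n, G⟩ : Σ n, BuildingGraph (Fin n)) = ⟨n', G'⟩ ∧ r = r' := by
  rw [encGraph_eq, encGraph_eq, List.append_assoc, List.append_assoc] at h
  obtain ⟨hv, h⟩ := encList_selfDelimiting encVertexData_selfDelimiting
    encVertexData_properStart _ _ _ _ h
  obtain ⟨he, rfl⟩ := encList_selfDelimiting (encList_selfDelimiting encEdgeData_selfDelimiting
    encEdgeData_properStart) (encList_properStart _) _ _ _ _ h
  refine ⟨?_, rfl⟩
  obtain rfl : n = n' := by simpa using congrArg List.length hv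
  replace hv := congrFun (List.ofFn_injective hv)
  have he' : ∀ u v, edgeData G u v = edgeData G' u v := fun u v =>
    congrFun (List.ofFn_injective (congrFun (List.ofFn_injective he) u)) v
  obtain ⟨E, EX, hEX, c, d, hd⟩ := G
  obtain ⟨E', EX', hEX', c', d', hd'⟩ := G'
  obtain rfl : E = E' := by
    ext ⟨u, v⟩
    have := congrArg Option.isSome (he' u v)
    by_cases h1 : (u, v) ∈ E <;> by_cases h2 : (u, v) ∈ E' <;> simp_all [edgeData]
  obtain rfl : EX = EX' := by
    ext v
    simpa using congrArg Prod.fst (hv v)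
  have hce : ∀ e, c (Sum.inr e) = c' (Sum.inr e) ∧ d (Sum.inr e) = d' (Sum.inr e) := by
    rintro ⟨⟨u, v⟩, h⟩
    simpa [edgeData, h] using he' u v
  obtain rfl : c = c' := by
    funext x
    rcases x with v | e
    · exact congrArg Prod.snd (hv v)
    · exact (hce e).1
  obtain rfl : d = d' := by
    funext x
    rcases x with v | e
    · rw [hd, hd']
    · exact (hce e).2
  rfl

theorem encInstr_selfDelimiting : SelfDelimiting encInstr := by
  have hl := encList_selfDelimiting encNat_selfDelimiting encNat_properStart
  rintro (⟨k, a, b⟩ | ⟨k, a, b⟩) (⟨k', a', b'⟩ | ⟨k', a', b'⟩) r s h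
  · simp only [encInstr, List.cons_append, List.cons.injEq, true_and, List.append_assoc] at h
    obtain ⟨rfl, t1⟩ := encNat_selfDelimiting _ _ _ _ h
    obtain ⟨rfl, t2⟩ := encNat_selfDelimiting _ _ _ _ t1
    obtain ⟨rfl, rfl⟩ := encNat_selfDelimiting _ _ _ _ t2
    exact ⟨rfl, rfl⟩
  · simp [encInstr] at h
  · simp [encInstr] at h
  · simp only [encInstr, List.cons_append, List.cons.injEq, true_and, List.append_assoc] at h
    obtain ⟨rfl, t3⟩ := encNat_selfDelimiting _ _ _ _ h
    obtain ⟨rfl, t4⟩ := encNat_selfDelimiting _ _ _ _ t3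
    obtain ⟨rfl, rfl⟩ := hl _ _ _ _ t4
    exact ⟨rfl, rfl⟩

theorem encInstr_properStart : ProperStart encInstr := by
  rintro (⟨k, a, b⟩ | ⟨k, a, b⟩) <;> exact ⟨_, _, rfl, by simp⟩

theorem behaviorCode_enc_injective : Function.Injective BehaviorCode.enc := by
  rintro ⟨c, d, t⟩ ⟨c', d', t'⟩ h
  simp only [BehaviorCode.enc] at h
  obtain ⟨rfl, t1⟩ := encList_selfDelimiting encInstr_selfDelimiting encInstr_properStart _ _ _ _ h
  obtain ⟨rfl, t2⟩ := encBits_selfDelimiting _ _ _ _ t1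
  obtain rfl := encUnary_selfDelimiting.injective t2
  rfl

theorem toNat_injective : Function.Injective Symbol.toNat := by
  rintro (_ | _) (_ | _) h <;> first | rfl | cases h

/-- A program describes at most one behavior model. -/
theorem BehaviorCode.Describes.unique {B : BehaviorCode} {n m tmax : ℕ}
    {G : BuildingGraph (Fin n)} {s₀ : State G (Fin m)} {β β' : BehaviorModel G s₀ tmax}
    (h : B.Describes β) (h' : B.Describes β') : β = β' := by
  funext es
  obtain ⟨l, ho, hl⟩ := h es
  obtain ⟨l', ho', hl'⟩ := h' es
  have hx : SelfDelimiting fun x : ℚ≥0 × WES G s₀ tmax =>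
      encNat x.1.num ++ (encNat x.1.den ++ encSchedule x.2.1) := by
    rintro ⟨a, v⟩ ⟨b, w⟩ r s h
    simp only [List.append_assoc] at h
    obtain ⟨h1, t1⟩ := encNat_selfDelimiting _ _ _ _ h
    obtain ⟨h2, t2⟩ := encNat_selfDelimiting _ _ _ _ t1
    obtain ⟨h3, rfl⟩ := encSchedule_selfDelimiting _ _ _ _ t2
    exact ⟨Prod.ext (NNRat.ext_num_den h1 h2) (Subtype.ext h3), rfl⟩
  -- Both lists are decoded from stack 2 of the same computation.
  have hll : l = l' := (encList_selfDelimiting hx fun x => ⟨_, _, rfl, by simp⟩).injective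
    (toNat_injective.list_map (ho.2.symm.trans ho'.2))
  subst hll
  exact Subtype.ext (funext fun w => (hl w).trans (hl' w).symm)

/-- An instance is determined by its code. -/
theorem instance_enc_unique {I I' : Instance} {B B' : BehaviorCode} (hB : B.Describes I.β)
    (hB' : B'.Describes I'.β) (h : I.enc B = I'.enc B') : I = I' := by
  obtain ⟨n, m, tmax, G, hc, s₀, β, D, K, hK⟩ := I
  obtain ⟨n', m', tmax', G', hc', s₀', β', D', K', hK'⟩ := I'
  simp only [Instance.enc] at h
  obtain ⟨hG, t1⟩ := encGraph_unique h
  cases hG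
  obtain ⟨hs, t2⟩ := encState_unique t1
  cases hs
  obtain ⟨rfl, t3⟩ := encUnary_selfDelimiting _ _ _ _ t2
  obtain ⟨hD, t4⟩ := encNat_selfDelimiting _ _ _ _ t3
  obtain ⟨rfl, t5⟩ := encNat_selfDelimiting _ _ _ _ t4
  obtain rfl := behaviorCode_enc_injective t5
  obtain rfl := Fin.ext hD
  obtain rfl := hB.unique hB'
  rfl

/-! ### The building -/

/-- A building with two rooms and one exit. A person who moves between the rooms spells a string
of bits; nobody may stay on an edge. -/
def certGraph : BuildingGraph (Fin 3) where
  E := Finset.univ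
  EX := {2}
  EX_ssubset := by decide
  c := Sum.elim (fun _ => 1) fun _ => 0
  d := fun _ => 0
  d_vertex _ := rfl

theorem certGraph_edge_capacity (e : {e // e ∈ certGraph.E}) : certGraph.c (Sum.inr e) = 0 := rfl

/-- The schedule of a single person who is at the vertex `pos t` at time `t`. -/
def vertexSchedule {tmax : ℕ} (pos : Fin (tmax + 1) → Fin 3) :
    Schedule certGraph (Fin 1) tmax := fun t _ => Sum.inl (pos t)

/-- All pairs of vertices are edges, loops included, and travel takes no time, so absorption at the
exit is the only constraint. -/
theorem isWES_vertexSchedule {tmax : ℕ} {pos : Fin (tmax + 1) → Fin 3}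
    (h : ∀ t t', t < t' → pos t = 2 → pos t' = 2) : IsWES (vertexSchedule pos) where
  from_vertex p t t' _ v hv := by
    obtain rfl : pos t = v := Sum.inl_injective hv
    exact Or.inr (Or.inr ⟨⟨(pos t, pos t'), Finset.mem_univ _⟩, rfl, rfl⟩)
  from_edge p t t' _ e he := nomatch he
  travel_time p e t t' htt' _ _ := by
    have : (t : ℕ) ≤ t' := htt'
    simp only [certGraph]
    omega
  exit_absorbing p t t' htt' v hv hpos := by
    obtain rfl : pos t = v := Sum.inl_injective hpos
    have h2 : pos t = 2 := by simpa [certGraph] using hv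
    exact congrArg Sum.inl ((h t t' htt' h2).trans h2.symm)

theorem isSES_vertexSchedule {tmax : ℕ} {pos : Fin (tmax + 1) → Fin 3}
    (h : ∀ t t', t < t' → pos t = 2 → pos t' = 2) (hlast : pos (Fin.last tmax) = 2) :
    IsSES (vertexSchedule pos) where
  toIsWES := isWES_vertexSchedule h
  vertex_capacity t v := by
    simp only [certGraph, Sum.elim_inl]
    exact_mod_cast (Finset.card_le_univ _).trans (by simp)
  edge_capacity t e := by
    simp [certGraph_edge_capacity, vertexSchedule]
  all_evacuated p := ⟨2, by simp [certGraph], congrArg Sum.inl hlast⟩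

/-- Edges have capacity 0, so a strong schedule never places the person on one. -/
theorem IsSES.exists_vertexSchedule {tmax : ℕ} {es : Schedule certGraph (Fin 1) tmax}
    (h : IsSES es) : ∃ pos : Fin (tmax + 1) → Fin 3, es = vertexSchedule pos := by
  have : ∀ t, ∃ v : Fin 3, es t 0 = Sum.inl v := by
    intro t
    rcases he : es t 0 with v | e
    · exact ⟨v, rfl⟩
    · exfalso
      have h0 := h.edge_capacity t e
      rw [certGraph_edge_capacity, Nat.cast_nonpos, Finset.card_eq_zero,
        Finset.eq_empty_iff_forall_notMem] at h0
      exact h0 0 (by simpa using he)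
  choose pos hpos using this
  refine ⟨pos, funext fun t => funext fun p => ?_⟩
  rw [Subsingleton.elim p 0, hpos]
  rfl

/-! ### Certificates -/

/-- The bits spelled by a visit to a vertex. -/
def vertexBits : Fin 3 → List Bool
  | 0 => [false]
  | 1 => [true]
  | 2 => []

/-- The string spelled by a sequence of positions. -/
def spell (l : List (Fin 3)) : List Bool := l.flatMap vertexBits

theorem length_vertexBits_le (v : Fin 3) : (vertexBits v).length ≤ 1 := by
  fin_cases v <;> simp [vertexBits]

theorem length_spell_le (l : List (Fin 3)) : (spell l).length ≤ l.length := by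
  induction l with
  | nil => simp [spell]
  | cons v l ih =>
    have := length_vertexBits_le v
    simp only [spell, List.flatMap_cons, List.length_append, List.length_cons] at ih ⊢
    omega

/-- The certificate spelled by a schedule after time `0`. -/
def certificate {N : ℕ} (pos : Fin (N + 2) → Fin 3) : List Bool :=
  spell (List.ofFn fun i : Fin (N + 1) => pos i.succ)

/-- The last of the `N + 1` visits after time 0 is at the exit and spells nothing. -/
theorem length_certificate_le {N : ℕ} {pos : Fin (N + 2) → Fin 3}
    (h : pos (Fin.last (N + 1)) = 2) : (certificate pos).length ≤ N := by
  have h1 : (certificate pos) = spell (List.ofFn fun i : Fin N => pos i.castSucc.succ) := by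
    rw [certificate, List.ofFn_succ', List.concat_eq_append, spell, List.flatMap_append]
    simp [h, vertexBits, spell]
  rw [h1]
  exact (length_spell_le _).trans (by simp)

/-- The vertex that spells a bit; the exit stands for the end of the string. -/
def bitVertex : Option Bool → Fin 3
  | some false => 0
  | some true => 1
  | none => 2

theorem bitVertex_eq_two {o : Option Bool} : bitVertex o = 2 ↔ o = none := by
  rcases o with _ | _ | _ <;> simp [bitVertex]

theorem spell_ofFn_bitVertex (w : List Bool) (M : ℕ) (hM : w.length ≤ M) :
    spell (List.ofFn fun i : Fin M => bitVertex w[(i : ℕ)]?) = w := by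
  induction w generalizing M with
  | nil => simp [spell, bitVertex, vertexBits]
  | cons b w ih =>
    obtain ⟨M, rfl⟩ : ∃ M', M = M' + 1 := ⟨M - 1, by simp at hM; omega⟩
    have := ih M (by simpa using hM)
    rw [List.ofFn_succ]
    simp only [spell, List.flatMap_cons] at this ⊢
    simp only [Fin.val_zero, List.getElem?_cons_zero, Fin.val_succ, List.getElem?_cons_succ, this]
    cases b <;> rfl

/-- From time 1 on the person walks along the bits of `w` and then waits at the exit. The `N + 1`
times leave space for `N` bits and a final visit to the exit. -/
theorem exists_certificate_eq {N : ℕ} (w : List Bool) (hw : w.length ≤ N) :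
    ∃ pos : Fin (N + 2) → Fin 3, pos 0 = 0 ∧ pos (Fin.last (N + 1)) = 2 ∧
      (∀ t t', t < t' → pos t = 2 → pos t' = 2) ∧ certificate pos = w := by
  refine ⟨Fin.cons 0 fun i : Fin (N + 1) => bitVertex w[(i : ℕ)]?, rfl, ?_, ?_, ?_⟩
  · rw [← Fin.succ_last, Fin.cons_succ, bitVertex_eq_two]
    simpa using hw
  · intro t t' htt' h
    induction t using Fin.cases with
    | zero => simp at h
    | succ i =>
      induction t' using Fin.cases with
      | zero => simp at htt'
      | succ j =>
        rw [Fin.cons_succ, bitVertex_eq_two, List.getElem?_eq_none_iff] at h ⊢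
        exact h.trans (Nat.le_of_lt (Fin.succ_lt_succ_iff.1 htt'))
  · simp only [certificate, Fin.cons_succ]
    exact spell_ofFn_bitVertex w _ (by omega)

/-! ### Strings for schedules -/

/-- The code of the state in which the only person is at `v`. -/
def vertexCode (v : Fin 3) : List Symbol := encList (encLoc (G := certGraph)) [Sum.inl v]

theorem encSchedule_vertexSchedule {tmax : ℕ} (pos : Fin (tmax + 1) → Fin 3) :
    encSchedule (vertexSchedule pos) =
      .lpar :: (vertexCode (pos 0) ++
        ((List.ofFn fun i : Fin tmax => pos i.succ).flatMap vertexCode ++ [.rpar])) := by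
  have h : List.ofFn (vertexSchedule pos) =
      (List.ofFn pos).map (fun v _ => Sum.inl v : Fin 3 → State certGraph (Fin 1)) := by
    rw [List.map_ofFn]
    rfl
  rw [encSchedule, encList, h, List.flatMap_map, List.ofFn_succ]
  simp [encState, vertexCode]
  rfl

/-- The codes of the three vertices share their first three symbols and differ in the fourth, on
which `readCmd` branches. -/
theorem vertexCode_zero : vertexCode 0 = [.lpar, .zero, .lpar, .rpar, .rpar] := by
  simp [vertexCode, encList, encLoc, encNat, encBits]

theorem vertexCode_one : vertexCode 1 = [.lpar, .zero, .lpar, .one, .rpar, .rpar] := by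
  simp [vertexCode, encList, encLoc, encNat, encBits, encBit]

theorem vertexCode_two : vertexCode 2 = [.lpar, .zero, .lpar, .zero, .one, .rpar, .rpar] := by
  have : Nat.bits 2 = [false, true] := by simp [Nat.bits, Nat.binaryRec]
  simp [vertexCode, encList, encLoc, encNat, encBits, encBit, this]

theorem length_vertexCode_le (v : Fin 3) : (vertexCode v).length ≤ 7 := by
  fin_cases v
  · exact (congrArg List.length vertexCode_zero).trans_le (by simp)
  · exact (congrArg List.length vertexCode_one).trans_le (by simp)
  · exact (congrArg List.length vertexCode_two).trans_le (by simp)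

/-- The positions of a person who moves from room `0` to the vertex `v` at time `1`. -/
def moveTo (tmax : ℕ) (v : Fin 3) : Fin (tmax + 1) → Fin 3 := Fin.cons 0 fun _ => v

/-- The beginning of the output of the behavior program. -/
def outputPrefix : List Symbol :=
  .lpar :: (encNat 1 ++ (encNat 1 ++ (.lpar :: vertexCode 0)))

/-- The output of the behavior program that tells that everybody follows `moveTo tmax v`. -/
def outputCode (tmax : ℕ) (v : Fin 3) : List Symbol :=
  outputPrefix ++ ((List.replicate tmax ()).flatMap (fun _ => vertexCode v) ++ [.rpar, .rpar])

/-- The two ones are the numerator and the denominator of the probability 1 of the only listed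
schedule. -/
theorem outputCode_eq (tmax : ℕ) (v : Fin 3) :
    outputCode tmax v = .lpar :: ((encNat 1 ++ (encNat 1 ++
      encSchedule (vertexSchedule (moveTo tmax v)))) ++ [.rpar]) := by
  rw [encSchedule_vertexSchedule]
  simp [outputCode, outputPrefix, moveTo, List.flatMap_replicate]

/-! ### The behavior program -/

theorem polynomial_eval_mono (T : Polynomial ℕ) {a b : ℕ} (h : a ≤ b) : T.eval a ≤ T.eval b := by
  rw [Polynomial.eval_eq_sum, Polynomial.eval_eq_sum]
  exact Finset.sum_le_sum fun i _ => Nat.mul_le_mul_left _ (Nat.pow_le_pow_left h i)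

section Program

variable {tm : FinTM2}

/-- Remove `j` symbols from the schedule. -/
def dropCmd : ℕ → Cmd (SimΓ tm)
  | 0 => .skip
  | j + 1 => .seq (.pop (.inl .sched) .skip fun _ => .skip) (dropCmd j)

theorem runsWithin_dropCmd (l s : List Symbol) (d : List Bool) (o : List Symbol) (n : List Unit)
    (t : List Bool) (c : List (tm.Λ × tm.σ)) (T : ∀ k, List (UsedSymbol tm k)) :
    RunsWithin (dropCmd l.length) (simStore (l ++ s) d o n t c T) l.length
      (simStore s d o n t c T) := by
  induction l with
  | nil => exact (Runs.skip _).within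
  | cons a l ih =>
    refine (RunsWithin.seq (RunsWithin.pop_cons (a := a) (r := l ++ s) rfl ?_) ih).congr
      rfl rfl (t := 1 + 0 + l.length) (by simp; omega)
    rw [update_sched]
    exact (Runs.skip _).within

/-- Record a visit to the vertex `v`. -/
def recordCmd (v : Fin 3) : Cmd (SimΓ tm) :=
  .seq (.push (.inl .cnt) ()) (.pushAll (.inl .tmp) (vertexBits v))

theorem runsWithin_recordCmd (v : Fin 3) (s : List Symbol) (d : List Bool) (o : List Symbol)
    (n : List Unit) (t : List Bool) (c : List (tm.Λ × tm.σ)) (T : ∀ k, List (UsedSymbol tm k)) :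
    RunsWithin (recordCmd v) (simStore s d o n t c T) 2
      (simStore s d o (() :: n) (vertexBits v ++ t) c T) := by
  have h1 := (Runs.push (simStore s d o n t c T) (.inl .cnt) ()).within
  rw [update_cnt] at h1
  have h2 := (runs_pushAll (Γ := SimΓ tm) (.inl .tmp) (vertexBits v)
    (simStore s d o (() :: n) t c T)).within
  rw [update_tmp] at h2
  exact (h1.seq h2).mono (Nat.add_le_add_left (length_vertexBits_le v) 1)

/-- Read the rest of the code of a state, given the first symbol that differs. -/
def readVertexCmd : Symbol → Cmd (SimΓ tm)
  | .rpar => .seq (dropCmd 1) (recordCmd 0)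
  | .one => .seq (dropCmd 2) (recordCmd 1)
  | .zero => .seq (dropCmd 3) (recordCmd 2)
  | .lpar => .skip

/-- Read the rest of the code of a state, given its first symbol. -/
def readCmd : Symbol → Cmd (SimΓ tm)
  | .lpar => .seq (dropCmd 2) (.pop (.inl .sched) .skip readVertexCmd)
  | _ => .skip

/-- The first symbol of the code has already been removed by the surrounding loop. The bound is `8 =
2 + 1 + 3 + 2`: two common symbols, the branching, at most three remaining symbols, and the record.
-/
theorem runsWithin_readCmd (v : Fin 3) (s : List Symbol) (d : List Bool) (o : List Symbol)
    (n : List Unit) (t : List Bool) (c : List (tm.Λ × tm.σ)) (T : ∀ k, List (UsedSymbol tm k)) :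
    ∃ r, vertexCode v = .lpar :: r ∧ RunsWithin (readCmd .lpar)
      (simStore (r ++ s) d o n t c T) 8 (simStore s d o (() :: n) (vertexBits v ++ t) c T) := by
  have key : ∀ (a : Symbol) (l : List Symbol), l.length ≤ 3 →
      vertexCode v = .lpar :: .zero :: .lpar :: a :: l →
      readVertexCmd (tm := tm) a = .seq (dropCmd l.length) (recordCmd v) →
      ∃ r, vertexCode v = .lpar :: r ∧ RunsWithin (readCmd .lpar)
        (simStore (r ++ s) d o n t c T) 8
        (simStore s d o (() :: n) (vertexBits v ++ t) c T) := by
    intro a l hl hv ha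
    refine ⟨_, hv, ((runsWithin_dropCmd [.zero, .lpar] (a :: l ++ s) d o n t c T).seq
      (RunsWithin.pop_cons (a := a) (r := l ++ s) rfl ?_ (t := l.length + 2))).mono
      (by simp; omega)⟩
    rw [update_sched, ha]
    exact (runsWithin_dropCmd l s d o n t c T).seq (runsWithin_recordCmd v s d o n t c T)
  obtain rfl | rfl | rfl : v = 0 ∨ v = 1 ∨ v = 2 := by fin_cases v <;> simp
  · exact key .rpar [.rpar] (by simp) vertexCode_zero rfl
  · exact key .one [.rpar, .rpar] (by simp) vertexCode_one rfl
  · exact key .zero [.one, .rpar, .rpar] (by simp) vertexCode_two rfl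

theorem reverse_vertexBits (v : Fin 3) : (vertexBits v).reverse = vertexBits v := by
  fin_cases v <;> rfl

/-- The bits are pushed in the order of reading and hence end up reversed; `loadCmd` reverses them
again. The count of visits is kept because the output schedule must have the same length. -/
theorem runsWithin_readLoop (vs : List (Fin 3)) (d : List Bool) (o : List Symbol)
    (n : List Unit) (t : List Bool) (c : List (tm.Λ × tm.σ)) (T : ∀ k, List (UsedSymbol tm k)) :
    RunsWithin (.loop (.inl .sched) readCmd)
      (simStore (vs.flatMap vertexCode ++ [.rpar]) d o n t c T) (9 * vs.length + 2)
      (simStore [] d o (List.replicate vs.length () ++ n) ((spell vs).reverse ++ t) c T) := by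
  induction vs generalizing n t with
  | nil =>
    -- The parenthesis that closes the schedule is read and ignored.
    refine RunsWithin.loop_cons (a := .rpar) (r := []) (t := 0) (u := 1) rfl ?_
      (Runs.loop_nil rfl).within
    rw [update_sched]
    exact (Runs.skip _).within
  | cons v vs ih =>
    obtain ⟨r, hr, h1⟩ := runsWithin_readCmd v (vs.flatMap vertexCode ++ [.rpar]) d o n t c T
    refine (RunsWithin.loop_cons (a := .lpar) (r := r ++ (vs.flatMap vertexCode ++ [.rpar])) ?_
      (h1.congr (update_sched ..) rfl le_rfl) (ih (() :: n) (vertexBits v ++ t))).congr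
      rfl ?_ ?_
    · simp [simStore, hr]
    · congr 1
      · rw [List.length_cons, List.replicate_succ', List.append_assoc]
        rfl
      · simp [spell, reverse_vertexBits]
    · rw [List.length_cons]; omega

/-- Push the string `x#w` on the input stack of the simulated machine, where the reverse of `w` is
on stack `tmp` and `x` is on stack `data`. -/
noncomputable def loadCmd (e : tm.Γ tm.k₀ ≃ Option Bool) : Cmd (SimΓ tm) :=
  .seq (.loop (.inl .tmp) fun b => .pushAll (.inr tm.k₀) [toUsed tm tm.k₀ (e.symm (some b))])
    (.seq (.pushAll (.inr tm.k₀) [toUsed tm tm.k₀ (e.symm none)])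
      (.seq (.loop (.inl .data) fun b => .pushAll (.inl .tmp) [b])
        (.loop (.inl .tmp) fun b =>
          .pushAll (.inr tm.k₀) [toUsed tm tm.k₀ (e.symm (some b))])))

theorem runsWithin_loop_tmp (e : tm.Γ tm.k₀ ≃ Option Bool) (s : List Symbol) (d w : List Bool)
    (o : List Symbol) (n : List Unit) (c : List (tm.Λ × tm.σ)) (y : List (Option Bool)) :
    RunsWithin (.loop (.inl .tmp) fun b =>
        .pushAll (.inr tm.k₀) [toUsed tm tm.k₀ (e.symm (some b))])
      (simStore s d o n w.reverse c (usedStacks (Store.single tm.k₀ (y.map e.symm))))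
      (2 * w.length + 1)
      (simStore s d o n [] c (usedStacks (Store.single tm.k₀ ((w.map some ++ y).map e.symm)))) := by
  have h := runs_loop_pushAll (Γ := SimΓ tm) (k := .inl .tmp) (k' := .inr tm.k₀) (by simp)
    (fun b => [toUsed tm tm.k₀ (e.symm (some b))]) 1 (by simp) w.reverse
    (simStore s d o n w.reverse c (usedStacks (Store.single tm.k₀ (y.map e.symm)))) rfl
  rw [update_tmp, update_inr, List.length_reverse, List.reverse_reverse] at h
  refine h.congr rfl (congrArg _ ?_) le_rfl
  funext k
  by_cases hk : k = tm.k₀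
  · subst hk
    simp [usedStacks, Store.single, simStore, List.map_eq_flatMap, List.flatMap_assoc]
  · simp [usedStacks, Store.single, hk]

/-- A stack is filled from the bottom, so `w` comes first, then the separator, then `x`, which is
reversed by way of `tmp`. -/
theorem runsWithin_loadCmd (e : tm.Γ tm.k₀ ≃ Option Bool) (s : List Symbol) (x w : List Bool)
    (o : List Symbol) (n : List Unit) (c : List (tm.Λ × tm.σ)) :
    RunsWithin (loadCmd e) (simStore s x o n w.reverse c fun _ => [])
      ((2 * w.length + 1) + (1 + ((2 * x.length + 1) + (2 * x.length + 1))))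
      (simStore s [] o n [] c
        (usedStacks (Store.single tm.k₀ ((encPair (x, w)).map e.symm)))) := by
  have h1 := runsWithin_loop_tmp e s x w o n c []
  have h2 := (runs_pushAll (Γ := SimΓ tm) (.inr tm.k₀) [toUsed tm tm.k₀ (e.symm none)]
    (simStore s x o n [] c (usedStacks (Store.single tm.k₀ ((w.map some ++ []).map e.symm))))).within
  rw [update_inr] at h2
  have h3 := runs_loop_pushAll (Γ := SimΓ tm) (k := .inl .data) (k' := .inl .tmp) (by simp)
    (fun b => [b]) 1 (by simp) x (simStore s x o n [] c (usedStacks (Store.single tm.k₀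
      ((none :: w.map some).map e.symm)))) rfl
  rw [update_data, update_tmp, flatMap_pure] at h3
  have h4 := runsWithin_loop_tmp e s [] x o n c (none :: w.map some)
  refine (h1.seq ((h2.congr rfl (congrArg _ ?_) le_rfl).seq
    ((h3.congr rfl ?_ le_rfl).seq h4))).congr (congrArg _ ?_) rfl le_rfl
  · funext k
    by_cases hk : k = tm.k₀
    · subst hk
      simp [usedStacks, Store.single, simStore]
    · simp [usedStacks, Store.single, hk]
  · exact congrArg (simStore s [] o n · c _) (List.append_nil _)
  · funext k
    by_cases hk : k = tm.k₀
    · subst hk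
      simp [usedStacks, Store.single]
    · simp [usedStacks, Store.single, hk]

/-- Write the output that tells that everybody moves to `v`. -/
def writeCmd (v : Fin 3) : Cmd (SimΓ tm) :=
  .seq (.pushAll (.inl .out) [.rpar, .rpar])
    (.seq (.loop (.inl .cnt) fun _ => .pushAll (.inl .out) (vertexCode v))
      (.pushAll (.inl .out) outputPrefix))

theorem runsWithin_writeCmd (v : Fin 3) (s : List Symbol) (d : List Bool) (tmax : ℕ)
    (t : List Bool) (c : List (tm.Λ × tm.σ)) (T : ∀ k, List (UsedSymbol tm k)) :
    RunsWithin (writeCmd v) (simStore s d [] (List.replicate tmax ()) t c T)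
      (2 + ((8 * tmax + 1) + outputPrefix.length))
      (simStore s d (outputCode tmax v) [] t c T) := by
  have h1 := (runs_pushAll (Γ := SimΓ tm) (.inl .out) [.rpar, .rpar]
    (simStore s d [] (List.replicate tmax ()) t c T)).within
  rw [update_out] at h1
  have h2 := runs_loop_pushAll (Γ := SimΓ tm) (k := .inl .cnt) (k' := .inl .out) (by simp)
    (fun _ => vertexCode v) 7 (fun _ => length_vertexCode_le v) (List.replicate tmax ())
    (simStore s d [.rpar, .rpar] (List.replicate tmax ()) t c T) rfl
  rw [update_cnt, update_out, List.reverse_replicate, List.length_replicate] at h2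
  have h3 := (runs_pushAll (Γ := SimΓ tm) (.inl .out) outputPrefix
    (simStore s d ((List.replicate tmax ()).flatMap (fun _ => vertexCode v) ++ [.rpar, .rpar])
      [] t c T)).within
  rw [update_out] at h3
  exact h1.seq (h2.seq h3)

/-- The behavior program: simulate the machine on the parameters and the certificate spelled by
the schedule, and let everybody go to the exit if it accepts. -/
noncomputable def behaviorCmd (e : tm.Γ tm.k₀ ≃ Option Bool) (e' : tm.Γ tm.k₁ ≃ Bool) :
    Cmd (SimΓ tm) :=
  .seq (dropCmd 6) (.seq (.loop (.inl .sched) readCmd) (.seq (loadCmd e)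
    (.seq (.push (.inl .ctl) (tm.main, tm.initialState)) (.seq (simLoop tm)
      (.pop (.inr tm.k₁) .skip fun a =>
        writeCmd (if (a.map Subtype.val).map e' = some true then 2 else 0))))))

/-- `q` is the sum of the bounds for the phases; the certificate has length at most `p.eval
x.length`, so the verifier's input has length at most `x.length + 1 + p.eval x.length`. What the
verifier leaves on its stacks is irrelevant, hence the unspecified `R`. -/
theorem exists_runsWithin_behaviorCmd (e : tm.Γ tm.k₀ ≃ Option Bool) (e' : tm.Γ tm.k₁ ≃ Bool)
    (T p : Polynomial ℕ) (verify : List Bool × List Bool → Bool)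
    (hT : ∀ xw, Nonempty (TM2OutputsInTime tm ((encPair xw).map e.symm)
      (some ([verify xw].map e'.symm)) (T.eval (encPair xw).length))) :
    ∃ q : Polynomial ℕ, ∀ (x : List Bool) (N : ℕ), N = p.eval x.length →
      ∀ pos : Fin (N + 2) → Fin 3, pos 0 = 0 → pos (Fin.last (N + 1)) = 2 →
      ∃ R, RunsWithin (behaviorCmd e e')
        (simStore (encSchedule (vertexSchedule pos)) x [] [] [] [] fun _ => [])
        (q.eval x.length)
        (simStore [] [] (outputCode (N + 1)
          (if verify (x, certificate pos) = true then 2 else 0)) [] [] [] R) := by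
  obtain ⟨c, hc⟩ := exists_runsWithin_simLoop tm
  refine ⟨6 + ((9 * (p + 1) + 2) + (((2 * p + 1) + (1 + ((2 * Polynomial.X + 1) +
    (2 * Polynomial.X + 1)))) + (1 + ((Polynomial.C c * T.comp (Polynomial.X + 1 + p) + 1) +
    (1 + (2 + ((8 * (p + 1) + 1) + Polynomial.C outputPrefix.length))))))), ?_⟩
  intro x N hN pos h0 hlast
  let w := certificate pos
  have hwN : w.length ≤ N := length_certificate_le hlast
  -- The six dropped symbols are the opening parenthesis of the schedule and the code of the fixed
  -- initial state, which spells nothing.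
  have h1 := runsWithin_dropCmd (tm := tm) (.lpar :: vertexCode 0)
    ((List.ofFn fun i : Fin (N + 1) => pos i.succ).flatMap vertexCode ++ [.rpar])
    x [] [] [] [] fun _ => []
  have h2 := runsWithin_readLoop (tm := tm) (List.ofFn fun i : Fin (N + 1) => pos i.succ)
    x [] [] [] [] fun _ => []
  rw [List.append_nil, List.append_nil, List.length_ofFn] at h2
  have h3 := runsWithin_loadCmd e [] x w [] (List.replicate (N + 1) ()) []
  have h4 := (Runs.push (Γ := SimΓ tm) (simStore [] [] [] (List.replicate (N + 1) ()) [] []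
    (usedStacks (Store.single tm.k₀ ((encPair (x, w)).map e.symm)))) (.inl .ctl)
    (tm.main, tm.initialState)).within
  rw [update_ctl] at h4
  obtain ⟨⟨⟨m, hm⟩, hmT⟩⟩ := hT (x, w)
  have hused : AllUsed (initList tm ((encPair (x, w)).map e.symm)).stk := by
    rw [initList_stk]
    intro k a ha
    by_cases hk : k = tm.k₀
    · subst hk; exact Or.inl ⟨a, rfl⟩
    · simp [Store.single, hk] at ha
  obtain ⟨hS', h5⟩ := hc [] [] [] (List.replicate (N + 1) ()) [] m _ tm.initialState
    (haltList tm ([verify (x, w)].map e'.symm)).stk hused hm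
  rw [initList_stk] at h5
  have hout : (haltList tm ([verify (x, w)].map e'.symm)).stk tm.k₁ =
      [e'.symm (verify (x, w))] := by
    rw [haltList_stk]
    simp [Store.single]
  generalize (haltList tm ([verify (x, w)].map e'.symm)).stk = S' at hS' h5 hout
  have ha := map_val_toUsed tm (hS' tm.k₁ (e'.symm (verify (x, w))) (by simp [hout]))
  have h6 := runsWithin_writeCmd (tm := tm) (if verify (x, w) = true then 2 else 0) [] [] (N + 1)
    [] [] (Function.update (usedStacks S') tm.k₁ [])
  have h7 := RunsWithin.pop_cons (Γ := SimΓ tm) (k := .inr tm.k₁) (e := .skip)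
    (f := fun a => writeCmd (if (a.map Subtype.val).map e' = some true then 2 else 0))
    (S := simStore [] [] [] (List.replicate (N + 1) ()) [] [] (usedStacks S'))
    (a := toUsed tm tm.k₁ (e'.symm (verify (x, w)))) (r := [])
    (by simp [simStore, usedStacks, hout]) (by
      rw [update_inr, ha]
      simp only [Option.map_some, Equiv.apply_symm_apply, Option.some.injEq]
      exact h6)
  refine ⟨_, (h1.seq (h2.seq (h3.seq (h4.seq (h5.seq h7))))).congr ?_ rfl ?_⟩
  · rw [encSchedule_vertexSchedule, h0]
    rfl
  · have hlen : (encPair (x, w)).length ≤ x.length + 1 + N := by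
      simp [encPair]
      omega
    have hm' : c * m ≤ c * T.eval (x.length + 1 + N) :=
      Nat.mul_le_mul_left _ (hmT.trans (polynomial_eval_mono T hlen))
    have hv : (Symbol.lpar :: vertexCode 0).length = 6 := by rw [vertexCode_zero]; rfl
    simp only [Polynomial.eval_add, Polynomial.eval_mul, Polynomial.eval_comp, Polynomial.eval_C,
      Polynomial.eval_X, Polynomial.eval_one, Polynomial.eval_ofNat, ← hN, hv]
    omega

end Program

/-- The numbers of the stacks of the simulating program. -/
noncomputable def stackNumber (tm : FinTM2) : Reg ⊕ tm.K → ℕ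
  | .inl .sched => 0
  | .inl .data => 1
  | .inl .out => 2
  | .inl .cnt => 3
  | .inl .tmp => 4
  | .inl .ctl => 5
  | .inr k =>
    letI := tm.kFin
    6 + Fintype.equivFin tm.K k

theorem stackNumber_injective (tm : FinTM2) : Function.Injective (stackNumber tm) := by
  rintro ((_ | _) | k) ((_ | _) | k') h <;>
    first
    | rfl
    | (simp only [stackNumber] at h; omega)
    | (simpa [stackNumber, Fin.val_inj] using h)

/-- A numbering of a finite type. -/
noncomputable def finiteCode {A : Type} (h : Finite A) (a : A) : ℕ := Finite.equivFin A a

theorem finiteCode_injective {A : Type} (h : Finite A) : Function.Injective (finiteCode h) :=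
  Fin.val_injective.comp (Finite.equivFin A).injective

theorem boolToNat_injective : Function.Injective Bool.toNat := by
  rintro (_ | _) (_ | _) h <;> first | rfl | cases h

/-- The numbers of the symbols of the simulating program. -/
noncomputable def symbolNumber (tm : FinTM2) : ∀ k, SimΓ tm k → ℕ
  | .inl .sched => Symbol.toNat
  | .inl .data => Bool.toNat
  | .inl .out => Symbol.toNat
  | .inl .cnt => fun _ => 0
  | .inl .tmp => Bool.toNat
  | .inl .ctl => finiteCode (finite_simΓ tm (.inl .ctl))
  | .inr k => finiteCode (finite_simΓ tm (.inr k))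

theorem symbolNumber_injective (tm : FinTM2) : ∀ k, Function.Injective (symbolNumber tm k)
  | .inl .sched => toNat_injective
  | .inl .data => boolToNat_injective
  | .inl .out => toNat_injective
  | .inl .cnt => fun _ _ _ => rfl
  | .inl .tmp => boolToNat_injective
  | .inl .ctl => finiteCode_injective _
  | .inr _ => finiteCode_injective _

/-- The quantifiers matter: `code` and `q` precede `x`, so the reduction can print the instructions
as a constant string. -/
theorem exists_behaviorCode (tm : FinTM2) (e : tm.Γ tm.k₀ ≃ Option Bool) (e' : tm.Γ tm.k₁ ≃ Bool)
    (T p : Polynomial ℕ) (verify : List Bool × List Bool → Bool)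
    (hT : ∀ xw, Nonempty (TM2OutputsInTime tm ((encPair xw).map e.symm)
      (some ([verify xw].map e'.symm)) (T.eval (encPair xw).length))) :
    ∃ (code : List Instr) (q : Polynomial ℕ), ∀ (x : List Bool) (N : ℕ), N = p.eval x.length →
      ∀ pos : Fin (N + 2) → Fin 3, pos 0 = 0 → pos (Fin.last (N + 1)) = 2 →
      BehaviorCode.Outputs ⟨code, x, q.eval x.length⟩ (encSchedule (vertexSchedule pos))
        (outputCode (N + 1) (if verify (x, certificate pos) = true then 2 else 0)) := by
  obtain ⟨q, hq⟩ := exists_runsWithin_behaviorCmd e e' T p verify hT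
  obtain ⟨code, hcode⟩ := exists_code (stackNumber tm) (stackNumber_injective tm)
    (symbolNumber tm) (symbolNumber_injective tm) (behaviorCmd e e') _ rfl
  refine ⟨code, q, fun x N hN pos h0 hlast => ?_⟩
  obtain ⟨R, hR⟩ := hq x N hN pos h0 hlast
  obtain ⟨h1, h2⟩ := hcode _ _ _ (BehaviorCode.init ⟨code, x, q.eval x.length⟩
    (encSchedule (vertexSchedule pos))).stk hR (by
      rintro ((_ | _) | k)
      iterate 6 rfl
      have h6 : 6 ≤ stackNumber tm (.inr k) := Nat.le_add_right _ _
      simp only [BehaviorCode.init]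
      rw [if_neg (by omega), if_neg (by omega)]
      rfl)
  exact ⟨h1, h2 (.inl .out)⟩

/-! ### The reduction -/

/-- Everybody starts in room `0`. -/
def startState : State certGraph (Fin 1) := fun _ => Sum.inl 0

/-- The schedule in which the person moves to `v` at time `1` and stays there. -/
def moveWES (tmax : ℕ) (v : Fin 3) : WES certGraph startState tmax :=
  ⟨vertexSchedule (moveTo tmax v), isWES_vertexSchedule (by
    intro t t' htt' h
    induction t using Fin.cases with
    | zero => simp [moveTo] at h
    | succ i =>
      induction t' using Fin.cases with
      | zero => simp at htt'
      | succ j => exact h), rfl⟩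

/-- The positions of the person in a schedule, if these are vertices. -/
def positions {tmax : ℕ} (es : Schedule certGraph (Fin 1) tmax) (t : Fin (tmax + 1)) : Fin 3 :=
  Sum.elim id (fun _ => 2) (es t 0)

open Classical in
/-- The behavior model in which the person goes to the exit at once if the certificate spelled by
the given schedule is accepted by `a`, and stays in the room otherwise. -/
noncomputable def certBehavior (N : ℕ) (a : List Bool → Bool) :
    BehaviorModel certGraph startState (N + 1) := fun es =>
  ⟨Pi.single (moveWES (N + 1) (if a (certificate (positions es.1)) = true then 2 else 0)) 1,
    single_mem_stdSimplex ℝ _⟩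

/-- The instance that asks for a certificate of length at most `N` that is accepted by `a`. -/
noncomputable def certInstance (N : ℕ) (a : List Bool → Bool) : Instance where
  n := 3
  m := 1
  tmax := N + 1
  G := certGraph
  exit_capacity _ _ := le_rfl
  s₀ := startState
  β := certBehavior N a
  D := ⟨1, by omega⟩
  K := 1
  K_le := le_rfl

theorem numEvacuated_moveTo (N : ℕ) (v : Fin 3) :
    numEvacuated (vertexSchedule (moveTo (N + 1) v)) ⟨1, by omega⟩ = if v = 2 then 1 else 0 := by
  have h : ∀ p, (∃ u ∈ certGraph.EX, vertexSchedule (moveTo (N + 1) v) ⟨1, by omega⟩ p =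
      Sum.inl u) ↔ v = 2 := by
    intro p
    constructor
    · rintro ⟨u, hu, h⟩
      obtain rfl : v = u := Sum.inl_injective h
      exact Finset.mem_singleton.1 hu
    · rintro rfl
      exact ⟨2, Finset.mem_singleton_self _, rfl⟩
  simp only [numEvacuated, h]
  split <;> simp_all

/-- The distribution is a point mass, so one term of the sum survives. -/
theorem expectedEvacuated_certBehavior (N : ℕ) (a : List Bool → Bool)
    (es : SES certGraph startState (N + 1)) :
    expectedEvacuated (certBehavior N a) es ⟨1, by omega⟩ =
      if a (certificate (positions es.1)) = true then 1 else 0 := by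
  classical
  simp only [expectedEvacuated, certBehavior, Pi.single_apply, ite_mul, one_mul, zero_mul,
    Finset.sum_ite_eq', Finset.mem_univ, if_true]
  rw [moveWES, numEvacuated_moveTo]
  split <;> simp

theorem certInstance_isYes (N : ℕ) (a : List Bool → Bool) :
    (certInstance N a).IsYes ↔ ∃ w : List Bool, w.length ≤ N ∧ a w = true := by
  have hyes : (certInstance N a).IsYes ↔ ∃ es : SES certGraph startState (N + 1),
      a (certificate (positions es.1)) = true := by
    refine exists_congr fun es => ?_
    have := expectedEvacuated_certBehavior N a es
    change ((1 : ℕ) : ℝ) ≤ expectedEvacuated (certBehavior N a) es ⟨1, by omega⟩ ↔ _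
    rw [this]
    split <;> simp_all
  rw [hyes]
  constructor
  · rintro ⟨⟨es, hes, hs⟩, h⟩
    refine ⟨_, length_certificate_le ?_, h⟩
    obtain ⟨v, hv, hlast⟩ := hes.all_evacuated 0
    simp only [certGraph, Finset.mem_singleton] at hv
    simp [positions, hlast, hv]
  · rintro ⟨w, hw, h⟩
    obtain ⟨pos, h0, hlast, habs, rfl⟩ := exists_certificate_eq w hw
    exact ⟨⟨vertexSchedule pos, isSES_vertexSchedule habs hlast,
      funext fun _ => congrArg Sum.inl h0⟩, h⟩

/-- Every strong schedule comes from positions that begin in room 0 and end at the exit, so the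
program need be correct only on these. -/
theorem describes_certBehavior {B : BehaviorCode} {N : ℕ} {a : List Bool → Bool}
    (h : ∀ pos : Fin (N + 2) → Fin 3, pos 0 = 0 → pos (Fin.last (N + 1)) = 2 →
      B.Outputs (encSchedule (vertexSchedule pos))
        (outputCode (N + 1) (if a (certificate pos) = true then 2 else 0))) :
    B.Describes (certBehavior N a) := by
  classical
  classical
  rintro ⟨es, hes, hs⟩
  obtain ⟨pos, rfl⟩ := hes.exists_vertexSchedule
  have h0 : pos 0 = 0 := Sum.inl_injective (congrFun hs 0)
  have hlast : pos (Fin.last (N + 1)) = 2 := by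
    obtain ⟨v, hv, hlast⟩ := hes.all_evacuated 0
    simp only [certGraph, Finset.mem_singleton] at hv
    exact (Sum.inl_injective hlast).trans hv
  refine ⟨[(1, moveWES (N + 1) (if a (certificate pos) = true then 2 else 0))], ?_, fun w => ?_⟩
  · have := h pos h0 hlast
    rw [outputCode_eq] at this
    simpa [encList, moveWES] using this
  · change (Pi.single (moveWES (N + 1) (if a (certificate pos) = true then 2 else 0)) 1 :
      WES certGraph startState (N + 1) → ℝ) w = _
    rw [Pi.single_apply]
    simp only [List.map_cons, List.map_nil, List.sum_cons, List.sum_nil, add_zero, NNRat.cast_one]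
    exact if_congr eq_comm rfl rfl

/-- The string is regrouped into constant parts, unary numbers and `x`, the shape that
`polyTime_print` can print. -/
theorem certInstance_enc (N : ℕ) (a : List Bool → Bool) (code : List Instr) (x : List Bool)
    (t : ℕ) : (certInstance N a).enc ⟨code, x, t⟩ =
      (encGraph certGraph ++ encState startState) ++ (encUnary (N + 1) ++
        ((encNat 1 ++ (encNat 1 ++ encList encInstr code)) ++ (encBits x ++ encUnary t))) := by
  simp [Instance.enc, certInstance, BehaviorCode.enc]

end Evac

theorem mainTheorem1 : Evac.NPHard Evac.DEP := by
  intro L hL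
  obtain ⟨p, verify, ⟨M⟩, hL⟩ := hL
  obtain ⟨code, q, hcode⟩ := Evac.exists_behaviorCode M.tm M.inputAlphabet M.outputAlphabet
    M.time p verify fun xw => ⟨M.outputsFun xw⟩
  have hdesc : ∀ x : List Bool, Evac.BehaviorCode.Describes ⟨code, x, q.eval x.length⟩
      (Evac.certBehavior (p.eval x.length) fun w => verify (x, w)) := fun x =>
    Evac.describes_certBehavior (hcode x _ rfl)
  refine ⟨fun x => (Evac.certInstance (p.eval x.length) fun w => verify (x, w)).enc
    ⟨code, x, q.eval x.length⟩, ?_, fun x => ?_⟩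
  · simp only [Evac.certInstance_enc]
    have := Evac.polyTime_print (Evac.encGraph Evac.certGraph ++ Evac.encState Evac.startState)
      (Evac.encNat 1 ++ (Evac.encNat 1 ++ Evac.encList Evac.encInstr code)) (p + 1) q
    simpa only [Polynomial.eval_add, Polynomial.eval_one] using this
  · rw [hL, ← Evac.certInstance_isYes (p.eval x.length) fun w => verify (x, w)]
    constructor
    · exact fun h => ⟨_, _, hdesc x, rfl, h⟩
    -- Membership in DEP only yields some yes-instance with this code; unique readability identifies
    -- it with the constructed one.
    · rintro ⟨I, B, hB, henc, hI⟩
      rwa [← Evac.instance_enc_unique hB (hdesc x) henc]
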